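/- Theorem (spectrum of the free $p$-adic Dirac operator). Let $p$ be a prime number and $m\in\mathbb{R}$. Let $d^3x$ be the Haar measure of $\mathbb{Q}_p^3$ normalized by $\int_{\mathbb{Z}_p^3}d^3x=1$, let $\|\xi\|_p=\max_i|\xi_i|_p$, let $\mathcal{D}(\mathbb{Q}_p^3)$ be the space of locally constant functions $\mathbb{Q}_p^3\to\mathbb{C}$ with compact support, and let $\mathfrak{H}=L^2(\mathbb{Q}_p^3)\otimes\mathbb{C}^4$. Let $\mathcal{F}$ be the unitary operator of $L^2(\mathbb{Q}_p^3)$ that extends $(\mathcal{F}\varphi)(\xi)=\int\chi_p(\xi\cdot x)\varphi(x)\,d^3x$, $\varphi\in\mathcal{D}(\mathbb{Q}_p^3)$, where $\chi_p(y)=\exp(2\pi i\{y\}_p)$ and $\{y\}_p$ is the $p$-adic fractional part. For $k=1,2,3$ let $\boldsymbol{D}_{x_k}f=\mathcal{F}^{-1}(|\xi_k|_p\,\mathcal{F}f)$ be the Taibleson–Vladimirov derivative in $L^2(\mathbb{Q}_p^3)$, with domain $\{f: |\xi_k|_p\,\mathcal{F}f\in L^2\}$. Let $\alpha_k=\begin{pmatrix}0&\sigma_k\\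 \sigma_k&0\end{pmatrix}$ ($\sigma_k$ the Pauli matrices) and $\beta=\begin{pmatrix}1&0\\0&-1\end{pmatrix}$ be the $4\times4$ Dirac matrices, and let $$H^1(\mathbb{Q}_p^3)=\Big\{\psi\in\mathfrak{H}:\ \int_{\mathbb{Q}_p^3}\sum_{i=1}^4\max(1,\|\xi\|_p)^2\,|\mathcal{F}\psi_i(\xi)|^2\,d^3\xi<\infty\Big\}.$$ Let $\boldsymbol{H}_0=\sum_{k=1}^3\alpha_k\boldsymbol{D}_{x_k}+\beta m$ with domain $H^1(\mathbb{Q}_p^3)$. Then: 1. $\mathcal{D}(\mathbb{Q}_p^3)\otimes\mathbb{C}^4$ is dense in $\mathfrak{H}$ and contained in $H^1(\mathbb{Q}_p^3)$, and the restriction of $\boldsymbol{H}_0$ to it is essentially self-adjoint (densely defined, symmetric and closable, with self-adjoint closure). 2. $\boldsymbol{H}_0$ is self-adjoint on $H^1(\mathbb{Q}_p^3)$. 3. The spectrum of $(\boldsymbol{H}_0,H^1(\mathbb{Q}_p^3))$ is the union of the essential ranges of $\lambda$ and $-\lambda$, where $$\lambda(\xi)=\sqrt{|\xi_1|_p^2+|\xi_2|_p^2+|\xi_3|_p^2+m^2},\qquad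 \xi\in\mathbb{Q}_p^3,$$ and the essential range of a real function $f$ on $\mathbb{Q}_p^3$ is the set of all $y\in\mathbb{R}$ such that $\{\xi:|f(\xi)-y|<\varepsilon\}$ has positive measure for every $\varepsilon>0$. -/

import Mathlib

open MeasureTheory

noncomputable section

namespace PadicDirac

section CharacterAndMeasure

variable (p : ℕ) [Fact p.Prime]

/-- The Borel σ-algebra of `ℚ_p`. -/
instance instMeasurableSpacePadic : MeasurableSpace ℚ_[p] := borel ℚ_[p]

instance instBorelSpacePadic : BorelSpace ℚ_[p] := ⟨rfl⟩

/-- The space `ℚ_p³`; its norm is `‖x‖ = max |x_i|_p`. -/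
abbrev Q3 : Type := Fin 3 → ℚ_[p]

/-- The unit ball `ℤ_p³` as a compact set with non-empty interior. -/
def unitBall : TopologicalSpace.PositiveCompacts (Q3 p) where
  carrier := Metric.closedBall 0 1
  isCompact' := isCompact_closedBall 0 1
  interior_nonempty' :=
    ⟨0, Metric.ball_subset_interior_closedBall (Metric.mem_ball_self one_pos)⟩

/-- The Haar measure of `ℚ_p³`, normalized by `μ(ℤ_p³) = 1`. -/
def haar3 : Measure (Q3 p) := Measure.addHaarMeasure (unitBall p)

instance instIsAddHaarMeasureHaar3 : (haar3 p).IsAddHaarMeasure :=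
  inferInstanceAs (Measure.addHaarMeasure (unitBall p)).IsAddHaarMeasure

variable {p}

/-- The pole order `max(0, -ord x)` of a `p`-adic number. -/
def poleOrder (x : ℚ_[p]) : ℕ := (-x.valuation).toNat

theorem norm_mul_pow_poleOrder (x : ℚ_[p]) : ‖x * (p : ℚ_[p]) ^ poleOrder x‖ ≤ 1 := by
  by_cases hx : x = 0
  · simp [hx]
  have hp : (1 : ℝ) ≤ p := by exact_mod_cast (Fact.out : p.Prime).one_lt.le
  have hp0 : (p : ℝ) ≠ 0 := by positivity
  rw [norm_mul, Padic.norm_eq_zpow_neg_valuation hx, Padic.norm_p_pow, ← zpow_add₀ hp0]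
  apply zpow_le_one_of_nonpos₀ hp
  simp only [poleOrder]
  omega

/-- The fractional part `{x}_p`: if `x = p^(-n) ∑_{j ≥ 0} x_j p^j` with `n = max(0, -ord x)` and
digits `x_j ∈ {0, …, p-1}`, then `{x}_p = p^(-n) ∑_{j < n} x_j p^j`
(`PadicInt.appr y n` is the sum of the first `n` terms of the `p`-adic expansion of `y`). -/
def fractPart (x : ℚ_[p]) : ℚ :=
  (PadicInt.appr ⟨x * (p : ℚ_[p]) ^ poleOrder x, norm_mul_pow_poleOrder x⟩ (poleOrder x) : ℚ) /
    (p : ℚ) ^ poleOrder x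

/-- The standard additive character `χ_p(x) = exp(2πi {x}_p)` of `ℚ_p`. -/
def chi (x : ℚ_[p]) : ℂ := Complex.exp (2 * Real.pi * Complex.I * (fractPart x : ℂ))

theorem norm_sub_fractPart_le (x : ℚ_[p]) : ‖x - (fractPart x : ℚ_[p])‖ ≤ 1 := by
  set n := poleOrder x with hn
  set y : ℤ_[p] := ⟨x * (p : ℚ_[p]) ^ poleOrder x, norm_mul_pow_poleOrder x⟩ with hy
  have hp0 : (p : ℚ_[p]) ≠ 0 := by exact_mod_cast (Fact.out : p.Prime).ne_zero
  have h := (PadicInt.norm_le_pow_iff_mem_span_pow (y - (y.appr n : ℤ_[p])) n).2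
    (PadicInt.appr_spec n y)
  have h2 : x - (fractPart x : ℚ_[p]) =
      ((y - (y.appr n : ℤ_[p]) : ℤ_[p]) : ℚ_[p]) * ((p : ℚ_[p]) ^ n)⁻¹ := by
    have h3 : (y : ℚ_[p]) = x * (p : ℚ_[p]) ^ n := rfl
    have h4 : fractPart x = (y.appr n : ℚ) / (p : ℚ) ^ n := rfl
    rw [h4]
    push_cast
    rw [h3]
    field_simp
  rw [h2, norm_mul, norm_inv, Padic.norm_p_pow]
  have hp1 : (0 : ℝ) < p := by exact_mod_cast (Fact.out : p.Prime).pos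
  have h3 : ‖((y - (y.appr n : ℤ_[p]) : ℤ_[p]) : ℚ_[p])‖ ≤ (p : ℝ) ^ (-(n : ℤ)) := h
  have hpos : (0 : ℝ) < (p : ℝ) ^ (-(n : ℤ)) := zpow_pos hp1 _
  calc _ ≤ (p : ℝ) ^ (-(n : ℤ)) * ((p : ℝ) ^ (-(n : ℤ)))⁻¹ := by gcongr
    _ = 1 := mul_inv_cancel₀ hpos.ne'

theorem exists_int_of_norm_le_one (q : ℚ) (N : ℕ) (a : ℤ) (hq : q * (p : ℚ) ^ N = a)
    (h : ‖(q : ℚ_[p])‖ ≤ 1) : ∃ b : ℤ, q = b := by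
  have hp0 : (p : ℚ) ≠ 0 := by exact_mod_cast (Fact.out : p.Prime).ne_zero
  have h1 : ‖((a : ℤ) : ℚ_[p])‖ ≤ (p : ℝ) ^ (-(N : ℤ)) := by
    have : ((a : ℤ) : ℚ_[p]) = (q : ℚ_[p]) * (p : ℚ_[p]) ^ N := by
      have := congrArg (fun t : ℚ => (t : ℚ_[p])) hq
      push_cast at this
      exact this.symm
    rw [this, norm_mul, Padic.norm_p_pow]
    exact mul_le_of_le_one_left (by positivity) h
  rw [Padic.norm_int_le_pow_iff_dvd] at h1
  obtain ⟨b, hb⟩ := h1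
  refine ⟨b, ?_⟩
  rw [hb] at hq
  push_cast at hq
  have : (p : ℚ) ^ N ≠ 0 := pow_ne_zero _ hp0
  field_simp at hq
  linarith

theorem exp_fract_eq_one_iff (q : ℚ) :
    Complex.exp (2 * Real.pi * Complex.I * (q : ℂ)) = 1 ↔ ∃ b : ℤ, q = b := by
  rw [Complex.exp_eq_one_iff]
  have h : (2 * Real.pi * Complex.I : ℂ) ≠ 0 := Complex.two_pi_I_ne_zero
  constructor
  · rintro ⟨n, hn⟩
    refine ⟨n, ?_⟩
    rw [mul_comm] at hn
    exact_mod_cast mul_right_cancel₀ h hn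
  · rintro ⟨b, rfl⟩
    exact ⟨b, by push_cast; ring⟩

theorem fractPart_mul_pow (x : ℚ_[p]) :
    ∃ a : ℤ, fractPart x * (p : ℚ) ^ poleOrder x = a := by
  have hp0 : (p : ℚ) ≠ 0 := by exact_mod_cast (Fact.out : p.Prime).ne_zero
  refine ⟨(PadicInt.appr ⟨_, norm_mul_pow_poleOrder x⟩ (poleOrder x) : ℕ), ?_⟩
  rw [fractPart, div_mul_cancel₀ _ (pow_ne_zero _ hp0)]
  push_cast
  rfl

theorem chi_add (x y : ℚ_[p]) : chi (x + y) = chi x * chi y := by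
  obtain ⟨a, ha⟩ := fractPart_mul_pow x
  obtain ⟨b, hb⟩ := fractPart_mul_pow y
  obtain ⟨c, hc⟩ := fractPart_mul_pow (x + y)
  obtain ⟨d, hd⟩ : ∃ d : ℤ, fractPart (x + y) - fractPart x - fractPart y = d := by
    refine exists_int_of_norm_le_one (p := p) _ (poleOrder x + poleOrder y + poleOrder (x + y))
      (c * p ^ (poleOrder x + poleOrder y) - a * p ^ (poleOrder y + poleOrder (x + y))
        - b * p ^ (poleOrder x + poleOrder (x + y))) ?_ ?_
    · push_cast
      rw [← ha, ← hb, ← hc]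
      ring
    · have e : ((fractPart (x + y) - fractPart x - fractPart y : ℚ) : ℚ_[p]) =
          (x - (fractPart x : ℚ_[p])) + ((y - (fractPart y : ℚ_[p]))
            - ((x + y) - (fractPart (x + y) : ℚ_[p]))) := by
        push_cast
        ring
      rw [e]
      refine (IsUltrametricDist.norm_add_le_max _ _).trans (max_le (norm_sub_fractPart_le x) ?_)
      rw [sub_eq_add_neg]
      refine (IsUltrametricDist.norm_add_le_max _ _).trans (max_le (norm_sub_fractPart_le y) ?_)
      rw [norm_neg]
      exact norm_sub_fractPart_le (x + y)
  have h1 := (exp_fract_eq_one_iff _).2 ⟨d, hd⟩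
  unfold chi
  rw [← Complex.exp_add, ← mul_one (Complex.exp (_ + _)), ← h1, ← Complex.exp_add]
  congr 1
  push_cast
  ring

theorem chi_eq_one_iff (x : ℚ_[p]) : chi x = 1 ↔ ‖x‖ ≤ 1 := by
  unfold chi
  rw [exp_fract_eq_one_iff]
  have e : x = (x - (fractPart x : ℚ_[p])) + (fractPart x : ℚ_[p]) := by ring
  have e' : (fractPart x : ℚ_[p]) = x + -(x - (fractPart x : ℚ_[p])) := by ring
  constructor
  · rintro ⟨b, hb⟩
    rw [e]
    refine (IsUltrametricDist.norm_add_le_max _ _).trans (max_le (norm_sub_fractPart_le x) ?_)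
    rw [hb]
    push_cast
    exact Padic.norm_int_le_one b
  · intro hx
    obtain ⟨a, ha⟩ := fractPart_mul_pow x
    refine exists_int_of_norm_le_one (p := p) _ _ a ha ?_
    rw [e']
    refine (IsUltrametricDist.norm_add_le_max _ _).trans (max_le hx ?_)
    rw [norm_neg]
    exact norm_sub_fractPart_le x

theorem norm_chi (x : ℚ_[p]) : ‖chi x‖ = 1 := by
  unfold chi
  have : (2 * Real.pi * Complex.I * (fractPart x : ℂ)) =
      ((2 * Real.pi * (fractPart x : ℝ) : ℝ) : ℂ) * Complex.I := by
    push_cast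
    ring
  rw [this, Complex.norm_exp_ofReal_mul_I]

theorem chi_add_of_norm_le (x y : ℚ_[p]) (hy : ‖y‖ ≤ 1) : chi (x + y) = chi x := by
  rw [chi_add, (chi_eq_one_iff y).2 hy, mul_one]

theorem isLocallyConstant_chi : IsLocallyConstant (chi : ℚ_[p] → ℂ) := by
  rw [IsLocallyConstant.iff_eventually_eq]
  intro x
  filter_upwards [Metric.closedBall_mem_nhds x one_pos] with y hy
  have := chi_add_of_norm_le x (y - x) (by simpa [dist_eq_norm] using hy)
  rwa [add_sub_cancel] at this

theorem continuous_chi : Continuous (chi : ℚ_[p] → ℂ) := isLocallyConstant_chi.continuous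

/-- The pairing `ξ · x = ∑_j ξ_j x_j` on `ℚ_p³`. -/
def pair (ξ x : Q3 p) : ℚ_[p] := ∑ j, ξ j * x j

theorem continuous_pair (ξ : Q3 p) : Continuous (pair ξ) := by
  unfold pair
  fun_prop

theorem pair_add (ξ x y : Q3 p) : pair ξ (x + y) = pair ξ x + pair ξ y := by
  simp [pair, mul_add, Finset.sum_add_distrib]

theorem norm_pair_le (ξ x : Q3 p) : ‖pair ξ x‖ ≤ ‖ξ‖ * ‖x‖ := by
  unfold pair
  refine IsUltrametricDist.norm_sum_le_of_forall_le_of_nonneg (by positivity) fun j _ => ?_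
  rw [norm_mul]
  gcongr
  · exact norm_le_pi_norm ξ j
  · exact norm_le_pi_norm x j

end CharacterAndMeasure

section TestFunctions

variable (p : ℕ) [Fact p.Prime]

/-- The Bruhat–Schwartz space `𝒟(ℚ_p³)`: locally constant complex functions with compact
support. -/
def testFun : Submodule ℂ (Q3 p → ℂ) where
  carrier := {φ | IsLocallyConstant φ ∧ HasCompactSupport φ}
  zero_mem' := ⟨IsLocallyConstant.const 0, HasCompactSupport.zero⟩
  add_mem' := fun ha hb => ⟨ha.1.add hb.1, ha.2.add hb.2⟩
  smul_mem' := fun c _ ha => ⟨ha.1.comp (fun z => c • z), ha.2.smul_left⟩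

variable {p}

theorem testFun_continuous (φ : testFun p) : Continuous (φ : Q3 p → ℂ) := φ.2.1.continuous

theorem testFun_memLp (φ : testFun p) : MemLp (φ : Q3 p → ℂ) 2 (haar3 p) :=
  (testFun_continuous φ).memLp_of_hasCompactSupport φ.2.2

/-- The integral `∫ χ_p(ξ · x) φ(x) dx`. -/
def fourierIntegral (φ : Q3 p → ℂ) (ξ : Q3 p) : ℂ :=
  ∫ x, chi (pair ξ x) * φ x ∂(haar3 p)

theorem integrable_chi_mul (φ : testFun p) (ξ : Q3 p) :
    Integrable (fun x => chi (pair ξ x) * (φ : Q3 p → ℂ) x) (haar3 p) :=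
  ((continuous_chi.comp (continuous_pair ξ)).mul
    (testFun_continuous φ)).integrable_of_hasCompactSupport φ.2.2.mul_left

theorem exists_period (φ : testFun p) :
    ∃ δ > 0, ∀ v : Q3 p, ‖v‖ < δ → ∀ x, (φ : Q3 p → ℂ) (x + v) = (φ : Q3 p → ℂ) x := by
  obtain ⟨f, hf, hK⟩ := φ
  have hU : IsOpen {z : Q3 p × Q3 p | f (z.1 + z.2) = f z.1} := by
    have h1 : IsLocallyConstant fun z : Q3 p × Q3 p => f (z.1 + z.2) - f z.1 :=
      (hf.comp_continuous (f := fun z : Q3 p × Q3 p => z.1 + z.2) (by fun_prop)).sub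
        (hf.comp_continuous (f := fun z : Q3 p × Q3 p => z.1) (by fun_prop))
    have := h1.isOpen_fiber 0
    simpa only [sub_eq_zero] using this
  obtain ⟨u, v, -, hv, hKu, h0v, huv⟩ := generalized_tube_lemma
    (s := tsupport f) (t := {(0 : Q3 p)}) hK isCompact_singleton hU (by
      rintro ⟨x, y⟩ ⟨-, hy⟩
      simp only [Set.mem_singleton_iff] at hy
      simp [hy])
  obtain ⟨δ, hδ, hball⟩ := Metric.isOpen_iff.1 hv 0 (h0v rfl)
  have key : ∀ w : Q3 p, ‖w‖ < δ → ∀ x ∈ tsupport f, f (x + w) = f x := fun w hw x hx =>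
    huv (show (x, w) ∈ u ×ˢ v from ⟨hKu hx, hball (by simpa using hw)⟩)
  refine ⟨δ, hδ, fun w hw x => ?_⟩
  by_cases hx : x ∈ tsupport f
  · exact key w hw x hx
  by_cases hxw : x + w ∈ tsupport f
  · have := key (-w) (by simpa using hw) (x + w) hxw
    rw [add_neg_cancel_right] at this
    exact this.symm
  · change f (x + w) = f x
    rw [image_eq_zero_of_notMem_tsupport hx, image_eq_zero_of_notMem_tsupport hxw]

theorem isLocallyConstant_fourierIntegral (φ : testFun p) :
    IsLocallyConstant (fourierIntegral (φ : Q3 p → ℂ)) := by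
  obtain ⟨R, hR⟩ := φ.2.2.isCompact.isBounded.exists_norm_le
  rw [IsLocallyConstant.iff_eventually_eq]
  intro ξ
  have hpos : (0 : ℝ) < (|R| + 1)⁻¹ := by positivity
  filter_upwards [Metric.closedBall_mem_nhds ξ hpos] with η hη
  unfold fourierIntegral
  congr 1
  funext x
  by_cases hx : x ∈ tsupport (φ : Q3 p → ℂ)
  · congr 1
    have e : pair η x = pair ξ x + pair (η - ξ) x := by
      simp [pair, sub_mul, Finset.sum_sub_distrib]
    rw [e]
    apply chi_add_of_norm_le
    refine (norm_pair_le _ _).trans ?_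
    rw [Metric.mem_closedBall, dist_eq_norm] at hη
    calc ‖η - ξ‖ * ‖x‖ ≤ (|R| + 1)⁻¹ * (|R| + 1) := by
          gcongr
          linarith [hR x hx, le_abs_self R]
      _ = 1 := inv_mul_cancel₀ (by positivity)
  · rw [image_eq_zero_of_notMem_tsupport hx, mul_zero, mul_zero]

theorem hasCompactSupport_fourierIntegral (φ : testFun p) :
    HasCompactSupport (fourierIntegral (φ : Q3 p → ℂ)) := by
  obtain ⟨δ, hδ, hper⟩ := exists_period φ
  obtain ⟨c, hc0, hcδ⟩ := NormedField.exists_norm_lt ℚ_[p] hδ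
  refine HasCompactSupport.of_support_subset_isCompact
    (isCompact_closedBall (0 : Q3 p) ‖c‖⁻¹) fun ξ hξ => ?_
  rw [mem_closedBall_zero_iff]
  refine (pi_norm_le_iff_of_nonneg (by positivity)).2 fun k => ?_
  have hp : pair ξ (Pi.single k c) = ξ k * c := by
    simp [pair, Pi.single_apply]
  have h1 : fourierIntegral (φ : Q3 p → ℂ) ξ =
      chi (ξ k * c) * fourierIntegral (φ : Q3 p → ℂ) ξ := by
    conv_lhs => unfold fourierIntegral
    rw [← integral_add_right_eq_self _ (Pi.single k c)]
    unfold fourierIntegral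
    rw [← integral_const_mul]
    congr 1
    funext x
    rw [hper _ (by rw [Pi.norm_single]; exact hcδ) x, pair_add, chi_add, hp]
    ring
  have h2 : chi (ξ k * c) = 1 :=
    (mul_right_cancel₀ hξ ((one_mul _).trans h1)).symm
  rw [chi_eq_one_iff, norm_mul] at h2
  rw [← one_div, le_div_iff₀ hc0]
  exact h2

variable (p)

/-- The Fourier transform `(𝓕φ)(ξ) = ∫ χ_p(ξ · x) φ(x) dx` on `𝒟(ℚ_p³)`. -/
def fourierTest : testFun p →ₗ[ℂ] testFun p where
  toFun φ := ⟨fourierIntegral (φ : Q3 p → ℂ),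
    isLocallyConstant_fourierIntegral φ, hasCompactSupport_fourierIntegral φ⟩
  map_add' φ ψ := by
    ext ξ
    simp only [fourierIntegral, Submodule.coe_add, Pi.add_apply, mul_add]
    exact integral_add (integrable_chi_mul φ ξ) (integrable_chi_mul ψ ξ)
  map_smul' c φ := by
    ext ξ
    simp only [fourierIntegral, Submodule.coe_smul, Pi.smul_apply, smul_eq_mul, RingHom.id_apply]
    rw [← integral_const_mul]
    congr 1
    funext x
    ring

/-- `L²(ℚ_p³)`. -/
abbrev L2 : Type := Lp ℂ 2 (haar3 p)

/-- The inclusion `𝒟(ℚ_p³) → L²(ℚ_p³)`. -/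
def testToL2 : testFun p →ₗ[ℂ] L2 p where
  toFun φ := (testFun_memLp φ).toLp _
  map_add' φ ψ := MemLp.toLp_add (testFun_memLp φ) (testFun_memLp ψ)
  map_smul' c φ := MemLp.toLp_const_smul c (testFun_memLp φ)

/-- The Fourier transform of `L²(ℚ_p³)`: the continuous extension of the Fourier transform of
`𝒟(ℚ_p³)`. -/
def fourierL2 : L2 p →L[ℂ] L2 p :=
  (testToL2 p ∘ₗ fourierTest p).extendOfNorm (testToL2 p)

end TestFunctions

section Operators

variable (p : ℕ) [Fact p.Prime]

variable {p} in
theorem coeFn_weight_add (w : Q3 p → ℝ) (f g : L2 p) :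
    (fun ξ => (w ξ : ℂ) * fourierL2 p (f + g) ξ) =ᵐ[haar3 p]
      (fun ξ => (w ξ : ℂ) * fourierL2 p f ξ) + fun ξ => (w ξ : ℂ) * fourierL2 p g ξ := by
  have e := map_add (fourierL2 p) f g
  filter_upwards [Lp.coeFn_add (fourierL2 p f) (fourierL2 p g)] with ξ h
  rw [e, h, Pi.add_apply, Pi.add_apply, mul_add]

variable {p} in
theorem coeFn_weight_smul (w : Q3 p → ℝ) (c : ℂ) (f : L2 p) :
    (fun ξ => (w ξ : ℂ) * fourierL2 p (c • f) ξ) =ᵐ[haar3 p]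
      c • fun ξ => (w ξ : ℂ) * fourierL2 p f ξ := by
  have e := map_smul (fourierL2 p) c f
  filter_upwards [Lp.coeFn_smul c (fourierL2 p f)] with ξ h
  rw [e, h, Pi.smul_apply, Pi.smul_apply, smul_eq_mul, smul_eq_mul]
  ring

/-- The elements `f` of `L²(ℚ_p³)` for which `w · 𝓕f` is again in `L²(ℚ_p³)`. -/
def weightDomain (w : Q3 p → ℝ) : Submodule ℂ (L2 p) where
  carrier := {f | MemLp (fun ξ => (w ξ : ℂ) * fourierL2 p f ξ) 2 (haar3 p)}
  zero_mem' := by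
    have h := coeFn_weight_smul w 0 (0 : L2 p)
    rw [zero_smul, zero_smul] at h
    exact (memLp_congr_ae h).2 MemLp.zero
  add_mem' {f g} hf hg := (memLp_congr_ae (coeFn_weight_add w f g)).2 (MemLp.add hf hg)
  smul_mem' c f hf := (memLp_congr_ae (coeFn_weight_smul w c f)).2 (MemLp.const_smul hf c)

variable {p} in
theorem weightDomain_memLp {w : Q3 p → ℝ} (f : weightDomain p w) :
    MemLp (fun ξ => (w ξ : ℂ) * fourierL2 p f ξ) 2 (haar3 p) := f.2

/-- Multiplication of the Fourier transform by `w`: the map `f ↦ w · 𝓕f`. -/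
def weightMul (w : Q3 p → ℝ) : weightDomain p w →ₗ[ℂ] L2 p where
  toFun f := (weightDomain_memLp f).toLp _
  map_add' f g := ((MemLp.toLp_eq_toLp_iff _ ((weightDomain_memLp f).add (weightDomain_memLp g))).2
    (coeFn_weight_add w f g)).trans (MemLp.toLp_add _ _)
  map_smul' c f := ((MemLp.toLp_eq_toLp_iff _ ((weightDomain_memLp f).const_smul c)).2
    (coeFn_weight_smul w c f)).trans (MemLp.toLp_const_smul c _)

/-- The pseudo-differential operator `f ↦ 𝓕⁻¹(w · 𝓕f)` with symbol `w`, an unbounded operator in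
`L²(ℚ_p³)` with domain `{f ; w · 𝓕f ∈ L²}`. -/
def pseudoDiff (w : Q3 p → ℝ) : L2 p →ₗ.[ℂ] L2 p where
  domain := weightDomain p w
  toFun := (fourierL2 p).inverse.toLinearMap ∘ₗ weightMul p w

/-- The Taibleson–Vladimirov derivative `D_{x_k}` with respect to the `k`-th variable: the
pseudo-differential operator with symbol `|ξ_k|_p`. -/
def taibleson (k : Fin 3) : L2 p →ₗ.[ℂ] L2 p := pseudoDiff p fun ξ => ‖ξ k‖

/-- The Hilbert space `L²(ℚ_p³) ⊕ L²(ℚ_p³) ⊕ L²(ℚ_p³) ⊕ L²(ℚ_p³)`. -/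
abbrev SpinorSpace : Type := PiLp 2 fun _ : Fin 4 => L2 p

/-- The image of `𝒟(ℚ_p³) ⊗ ℂ⁴` in the Hilbert space: all components are test functions. -/
def testSpinors : Submodule ℂ (SpinorSpace p) where
  carrier := {ψ | ∀ i, ψ i ∈ LinearMap.range (testToL2 p)}
  zero_mem' := fun _ => Submodule.zero_mem _
  add_mem' := fun ha hb i => Submodule.add_mem _ (ha i) (hb i)
  smul_mem' := fun c _ ha i => Submodule.smul_mem _ c (ha i)

/-- The first Sobolev space `H¹(ℚ_p³)` of spinors: the `ψ` in the Hilbert space for which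
`∑_i ∫ max(1, ‖ξ‖_p)² |𝓕ψ_i(ξ)|² dξ` is finite. -/
def sobolevH1 : Submodule ℂ (SpinorSpace p) where
  carrier := {ψ | ∀ i, ψ i ∈ weightDomain p fun ξ => max 1 ‖ξ‖}
  zero_mem' := fun _ => Submodule.zero_mem _
  add_mem' := fun ha hb i => Submodule.add_mem _ (ha i) (hb i)
  smul_mem' := fun c _ ha i => Submodule.smul_mem _ c (ha i)

variable {p} in
theorem sobolevH1_mem_taibleson {ψ : SpinorSpace p} (hψ : ψ ∈ sobolevH1 p) (k : Fin 3)
    (j : Fin 4) : ψ j ∈ (taibleson p k).domain := by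
  refine MemLp.mono (hψ j) ?_ (Filter.Eventually.of_forall fun ξ => ?_)
  · refine AEStronglyMeasurable.mul ?_ (Lp.aestronglyMeasurable _)
    exact (Complex.continuous_ofReal.comp (continuous_norm.comp
      (continuous_apply k))).aestronglyMeasurable
  · simp only [norm_mul, Complex.norm_real, norm_norm]
    gcongr
    exact (norm_le_pi_norm ξ k).trans ((le_max_right 1 ‖ξ‖).trans (le_abs_self _))

variable {p} in
/-- The `j`-th component of an element of `H¹`, as an element of the domain of `D_{x_k}`. -/
def component (k : Fin 3) (j : Fin 4) : sobolevH1 p →ₗ[ℂ] (taibleson p k).domain where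
  toFun ψ := ⟨(ψ : SpinorSpace p) j, sobolevH1_mem_taibleson ψ.2 k j⟩
  map_add' _ _ := rfl
  map_smul' _ _ := rfl

/-- The Pauli matrices. -/
def pauli : Fin 3 → Matrix (Fin 2) (Fin 2) ℂ :=
  ![!![0, 1; 1, 0], !![0, -Complex.I; Complex.I, 0], !![1, 0; 0, -1]]

/-- The Dirac matrices `α_k`, in `2 × 2` blocks. -/
def diracAlpha (k : Fin 3) : Matrix (Fin 4) (Fin 4) ℂ :=
  Matrix.reindex (finSumFinEquiv (m := 2) (n := 2)) (finSumFinEquiv (m := 2) (n := 2)) (Matrix.fromBlocks 0 (pauli k) (pauli k) 0)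

/-- The Dirac matrix `β`, in `2 × 2` blocks. -/
def diracBeta : Matrix (Fin 4) (Fin 4) ℂ :=
  Matrix.reindex (finSumFinEquiv (m := 2) (n := 2)) (finSumFinEquiv (m := 2) (n := 2))
    (Matrix.fromBlocks (1 : Matrix (Fin 2) (Fin 2) ℂ) 0 0 (-1))

/-- The free Dirac operator `H₀ = ∑_k α_k D_{x_k} + β m` with domain `H¹(ℚ_p³)`. -/
def freeDirac (m : ℝ) : SpinorSpace p →ₗ.[ℂ] SpinorSpace p where
  domain := sobolevH1 p
  toFun :=
    { toFun := fun ψ => WithLp.toLp 2 fun i =>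
        (∑ k : Fin 3, ∑ j : Fin 4, diracAlpha k i j • taibleson p k (component k j ψ)) +
          ∑ j : Fin 4, (diracBeta i j * (m : ℂ)) • (ψ : SpinorSpace p) j
      map_add' := fun φ ψ => by
        ext1 i
        simp only [map_add, LinearPMap.map_add, smul_add, Finset.sum_add_distrib,
          Submodule.coe_add, PiLp.add_apply]
        abel
      map_smul' := fun c ψ => by
        ext1 i
        simp only [map_smul, LinearPMap.map_smul, smul_comm _ c, ← Finset.smul_sum,
          Submodule.coe_smul, PiLp.smul_apply, RingHom.id_apply, smul_add] }

/-- The function `λ(ξ) = √(|ξ₁|_p² + |ξ₂|_p² + |ξ₃|_p² + m²)`. -/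
def energy (m : ℝ) (ξ : Q3 p) : ℝ := Real.sqrt (∑ k : Fin 3, ‖ξ k‖ ^ 2 + m ^ 2)

end Operators

section General

/-- The essential range of a real function: all `y` such that every neighbourhood `(y-ε, y+ε)` has
a preimage of positive measure. -/
def essRange {X : Type*} [MeasurableSpace X] (μ : Measure X) (f : X → ℝ) : Set ℝ :=
  {y | ∀ ε > 0, 0 < μ {x | |f x - y| < ε}}

variable {E : Type*} [NormedAddCommGroup E] [InnerProductSpace ℂ E]

/-- An unbounded operator is essentially self-adjoint if it is densely defined, symmetric, and
closable with self-adjoint closure. -/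
def IsEssentiallySelfAdjoint [CompleteSpace E] (A : E →ₗ.[ℂ] E) : Prop :=
  Dense (A.domain : Set E) ∧ A.IsFormalAdjoint A ∧ A.IsClosable ∧ IsSelfAdjoint A.closure

/-- The resolvent set of an unbounded operator `A`: all `z` for which `A - z`, from the domain of
`A` to the whole space, has a bounded two-sided inverse `R`. -/
def unboundedResolventSet (A : E →ₗ.[ℂ] E) : Set ℂ :=
  {z | ∃ R : E →L[ℂ] E, (∀ y : E, ∃ x : A.domain, (x : E) = R y ∧ A x - z • (x : E) = y) ∧
    ∀ x : A.domain, R (A x - z • (x : E)) = x}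

/-- The spectrum of an unbounded operator. -/
def unboundedSpectrum (A : E →ₗ.[ℂ] E) : Set ℂ := (unboundedResolventSet A)ᶜ

end General

end PadicDirac

end

/-! The Fourier transform is unitary and turns $H_0$ into multiplication by the Hermitian matrix
$A(\xi)=\sum_k|\xi_k|_p\alpha_k+m\beta$. The Clifford relations give $A^2=\lambda^2$, and all three
claims follow from this identity.

Unitarity: on test functions $\mathcal F^2$ is reflection (`fourierIntegral_fourierIntegral`), which
yields Parseval; density of test functions (`denseRange_testToL2`) extends it to $L^2$.

Self-adjointness: $(A-z)(A+z)=\lambda^2-z^2$ makes $(\lambda^2-z^2)^{-1}(A+z)$ the inverse of $A-z$.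
If $z$ stays away from the values of $\pm\lambda$, this inverse remains bounded after multiplication
by $\max(1,\|\xi\|)$, hence maps $L^2$ into $H^1$ (`mem_resolventSet_freeDirac`). With $z=\pm i$,
the symmetric operator has surjective $H_0\mp i$ and is therefore self-adjoint.

Core: the graph of $H_0$ is the image of the Hilbert space under a bounded map that sends test
spinors to test spinors, so the graph over test spinors is dense in it.

Spectrum: outside the essential ranges the resolvent above exists. If $y$ lies in the essential
range of $f=\pm\lambda$, the columns of $A+f$ are eigenvectors of $A$ for $f$; cut off to a bounded
set where $f$ is close to $y$, they are approximate eigenvectors (`notMem_resolventSet_freeDirac`).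
-/

noncomputable section

namespace PadicDirac

open scoped Pointwise ENNReal ComplexConjugate InnerProductSpace Matrix

/-! ### Fourier inversion, Parseval, and the unitary Fourier transform on $L^2(\mathbb{Q}_p^3)$. -/

section FourierInversion

variable {p : ℕ} [Fact p.Prime]

theorem units_smul_closedBall_one (c : ℚ_[p]ˣ) :
    c • Metric.closedBall (0 : Q3 p) 1 = Metric.closedBall 0 ‖(c : ℚ_[p])‖ := by
  have h : c • Metric.closedBall (0 : Q3 p) 1 = (c : ℚ_[p]) • Metric.closedBall (0 : Q3 p) 1 := rfl
  rw [h, smul_unitClosedBall]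

theorem haar3_closedBall_one : haar3 p (Metric.closedBall 0 1) = 1 :=
  Measure.addHaarMeasure_self (K₀ := unitBall p)

/-- Both balls are dilates of the unit ball, and the factor by which dilation scales Haar measure is
multiplicative in `c`; its explicit value is not needed. This is the normalization constant of
Fourier inversion. -/
theorem haar3_closedBall_mul (c : ℚ_[p]ˣ) :
    haar3 p (Metric.closedBall 0 ‖(c : ℚ_[p])‖) * haar3 p (Metric.closedBall 0 ‖(c : ℚ_[p])‖⁻¹)
      = 1 := by
  have h (g : ℚ_[p]ˣ) : haar3 p (Metric.closedBall 0 ‖(g : ℚ_[p])‖) =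
      distribHaarChar (Q3 p) g := by
    rw [← units_smul_closedBall_one, ← distribHaarChar_mul, haar3_closedBall_one, mul_one]
  have h' := h c⁻¹
  rw [Units.val_inv_eq_inv_val, norm_inv] at h'
  rw [h, h', ← ENNReal.coe_mul, ← map_mul, mul_inv_cancel, map_one, ENNReal.coe_one]

theorem pair_add_left (ξ η x : Q3 p) : pair (ξ + η) x = pair ξ x + pair η x := by
  simp [pair, add_mul, Finset.sum_add_distrib]

theorem pair_comm (ξ x : Q3 p) : pair ξ x = pair x ξ := by
  simp [pair, mul_comm]

theorem pair_neg (ξ x : Q3 p) : pair ξ (-x) = -pair ξ x := by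
  simp [pair, Finset.sum_neg_distrib]

theorem pair_single (ξ : Q3 p) (k : Fin 3) (c : ℚ_[p]) : pair ξ (Pi.single k c) = ξ k * c := by
  simp [pair, Pi.single_apply]

theorem conj_chi (x : ℚ_[p]) : conj (chi x) = chi (-x) := by
  have h : chi (-x) * chi x = 1 := by
    rw [← chi_add, neg_add_cancel, chi_eq_one_iff]
    simp
  have h2 : conj (chi x) * chi x = 1 := by
    rw [← Complex.normSq_eq_conj_mul_self, Complex.normSq_eq_norm_sq, norm_chi]
    simp
  exact mul_right_cancel₀ (right_ne_zero_of_mul_eq_one h) (h2.trans h.symm)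

/-- The indicator function of a compact open set times a locally constant function. -/
def testIndicator (C : Set (Q3 p)) (hC : IsClopen C) (hK : IsCompact C) (f : Q3 p → ℂ)
    (hf : IsLocallyConstant f) : testFun p :=
  ⟨C.indicator f, by
    rw [IsLocallyConstant.iff_eventually_eq]
    intro x
    by_cases hx : x ∈ C
    · filter_upwards [hC.isOpen.mem_nhds hx, hf.eventually_eq x] with y hy h
      rw [Set.indicator_of_mem hy, Set.indicator_of_mem hx, h]
    · filter_upwards [hC.compl.isOpen.mem_nhds hx] with y hy
      rw [Set.indicator_of_notMem hy, Set.indicator_of_notMem hx],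
    HasCompactSupport.intro hK fun _ hx => Set.indicator_of_notMem hx _⟩

theorem isClopen_closedBall_units (a : Q3 p) (c : ℚ_[p]ˣ) :
    IsClopen (Metric.closedBall a ‖(c : ℚ_[p])‖) :=
  IsUltrametricDist.isClopen_closedBall a (norm_ne_zero_iff.2 c.ne_zero)

/-- Orthogonality relations for the characters of a ball. -/
theorem setIntegral_chi_closedBall (c : ℚ_[p]ˣ) (z : Q3 p) :
    ∫ ξ in Metric.closedBall 0 ‖(c : ℚ_[p])‖, chi (pair z ξ) ∂(haar3 p) =
      (Metric.closedBall 0 ‖(c : ℚ_[p])‖⁻¹).indicator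
        (fun _ => ((haar3 p).real (Metric.closedBall 0 ‖(c : ℚ_[p])‖) : ℂ)) z := by
  have hc : 0 < ‖(c : ℚ_[p])‖ := norm_pos_iff.2 c.ne_zero
  by_cases hz : z ∈ Metric.closedBall 0 ‖(c : ℚ_[p])‖⁻¹
  · rw [Set.indicator_of_mem hz]
    rw [mem_closedBall_zero_iff] at hz
    have h : Set.EqOn (fun ξ => chi (pair z ξ)) (fun _ => (1 : ℂ))
        (Metric.closedBall 0 ‖(c : ℚ_[p])‖) := fun ξ hξ => by
      rw [mem_closedBall_zero_iff] at hξ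
      refine (chi_eq_one_iff _).2 ((norm_pair_le _ _).trans ?_)
      calc ‖z‖ * ‖ξ‖ ≤ ‖(c : ℚ_[p])‖⁻¹ * ‖(c : ℚ_[p])‖ := by gcongr
        _ = 1 := inv_mul_cancel₀ hc.ne'
    rw [setIntegral_congr_fun measurableSet_closedBall h]
    simp
  · rw [Set.indicator_of_notMem hz]
    -- Translation by `c` in coordinate `k` preserves the ball but multiplies the integral by `chi
    -- (z k * c) ≠ 1`, so the integral vanishes.
    obtain ⟨k, hk⟩ : ∃ k, ‖(c : ℚ_[p])‖⁻¹ < ‖z k‖ := by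
      by_contra! h
      exact hz (mem_closedBall_zero_iff.2 ((pi_norm_le_iff_of_nonneg (by positivity)).2 h))
    have h1 : chi (z k * (c : ℚ_[p])) ≠ 1 := by
      rw [Ne, chi_eq_one_iff, norm_mul, not_le]
      calc (1 : ℝ) = ‖(c : ℚ_[p])‖⁻¹ * ‖(c : ℚ_[p])‖ := (inv_mul_cancel₀ hc.ne').symm
        _ < ‖z k‖ * ‖(c : ℚ_[p])‖ := by gcongr
    rw [← integral_indicator measurableSet_closedBall]
    set f := (Metric.closedBall 0 ‖(c : ℚ_[p])‖).indicator fun ξ => chi (pair z ξ) with hf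
    have h2 : ∫ ξ, f ξ ∂(haar3 p) = chi (z k * (c : ℚ_[p])) * ∫ ξ, f ξ ∂(haar3 p) := by
      conv_lhs => rw [← integral_add_right_eq_self _ (Pi.single k (c : ℚ_[p]))]
      rw [← integral_const_mul]
      congr 1
      funext ξ
      have hv : ‖(Pi.single k (c : ℚ_[p]) : Q3 p)‖ ≤ ‖(c : ℚ_[p])‖ := (Pi.norm_single _).le
      have hmem : ξ + Pi.single k (c : ℚ_[p]) ∈ Metric.closedBall (0 : Q3 p) ‖(c : ℚ_[p])‖ ↔
          ξ ∈ Metric.closedBall (0 : Q3 p) ‖(c : ℚ_[p])‖ := by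
        simp only [mem_closedBall_zero_iff]
        constructor
        · intro h
          have := (IsUltrametricDist.norm_add_le_max (ξ + Pi.single k (c : ℚ_[p]))
            (-Pi.single k (c : ℚ_[p])))
          rw [add_neg_cancel_right, norm_neg] at this
          exact this.trans (max_le h hv)
        · exact fun h => (IsUltrametricDist.norm_add_le_max _ _).trans (max_le h hv)
      by_cases hξ : ξ ∈ Metric.closedBall (0 : Q3 p) ‖(c : ℚ_[p])‖
      · rw [hf, Set.indicator_of_mem hξ, Set.indicator_of_mem (hmem.2 hξ), pair_add, chi_add,
          pair_single, mul_comm]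
      · rw [hf, Set.indicator_of_notMem hξ, Set.indicator_of_notMem (fun h => hξ (hmem.1 h)),
          mul_zero]
    by_contra h0
    exact h1 (mul_right_cancel₀ h0 (h2.symm.trans (one_mul _).symm))

/-- Fubini for a continuous, compactly supported integrand, together with the symmetry of the
kernel. -/
theorem integral_fourierIntegral_mul (φ ψ : testFun p) :
    ∫ ξ, fourierIntegral (φ : Q3 p → ℂ) ξ * (ψ : Q3 p → ℂ) ξ ∂(haar3 p) =
      ∫ x, (φ : Q3 p → ℂ) x * fourierIntegral (ψ : Q3 p → ℂ) x ∂(haar3 p) := by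
  have hc : Continuous (Function.uncurry fun ξ x : Q3 p =>
      chi (pair ξ x) * (φ : Q3 p → ℂ) x * (ψ : Q3 p → ℂ) ξ) := by
    have h1 := testFun_continuous φ
    have h2 := testFun_continuous ψ
    have h3 : Continuous fun z : Q3 p × Q3 p => pair z.1 z.2 := by
      unfold pair
      fun_prop
    have h4 := continuous_chi (p := p)
    unfold Function.uncurry
    fun_prop
  have hs : HasCompactSupport (Function.uncurry fun ξ x : Q3 p =>
      chi (pair ξ x) * (φ : Q3 p → ℂ) x * (ψ : Q3 p → ℂ) ξ) := by
    refine HasCompactSupport.intro (ψ.2.2.isCompact.prod φ.2.2.isCompact) fun z hz => ?_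
    simp only [Set.mem_prod, not_and_or] at hz
    simp only [Function.uncurry]
    rcases hz with hz | hz
    · rw [image_eq_zero_of_notMem_tsupport hz, mul_zero]
    · rw [image_eq_zero_of_notMem_tsupport hz, mul_zero, zero_mul]
  have h := integral_integral_swap_of_hasCompactSupport (μ := haar3 p) (ν := haar3 p) hc hs
  have e1 (ξ : Q3 p) : fourierIntegral (φ : Q3 p → ℂ) ξ * (ψ : Q3 p → ℂ) ξ =
      ∫ x, chi (pair ξ x) * (φ : Q3 p → ℂ) x * (ψ : Q3 p → ℂ) ξ ∂(haar3 p) := by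
    rw [integral_mul_const, fourierIntegral]
  have e2 (x : Q3 p) : (φ : Q3 p → ℂ) x * fourierIntegral (ψ : Q3 p → ℂ) x =
      ∫ ξ, chi (pair ξ x) * (φ : Q3 p → ℂ) x * (ψ : Q3 p → ℂ) ξ ∂(haar3 p) := by
    rw [fourierIntegral, ← integral_const_mul]
    congr 1
    funext ξ
    rw [pair_comm x ξ]
    ring
  simp only [e1, e2]
  exact h

/-- Since $\hat\varphi$ has compact support, a cutoff to a large ball $B$ changes nothing. Moving
the transform onto the cut-off character turns the integral into the average of `φ` over the dual
ball around `-x`, where `φ` is constant. -/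
theorem fourierIntegral_fourierIntegral (φ : testFun p) (x : Q3 p) :
    fourierIntegral (fourierIntegral (φ : Q3 p → ℂ)) x = (φ : Q3 p → ℂ) (-x) := by
  obtain ⟨δ, hδ, hper⟩ := exists_period φ
  obtain ⟨R, hR⟩ := (hasCompactSupport_fourierIntegral φ).isCompact.isBounded.exists_norm_le
  -- Radius above `R` covers the support of the transform; above `δ⁻¹` it makes the dual ball
  -- smaller than the period of `φ`; the `1` ensures `c ≠ 0`.
  obtain ⟨c, hc⟩ := NormedField.exists_lt_norm ℚ_[p] (max (max R 1) δ⁻¹)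
  have hc0 : 0 < ‖c‖ := lt_trans (by positivity) hc
  lift c to ℚ_[p]ˣ using (norm_pos_iff.1 hc0).isUnit
  set B := Metric.closedBall (0 : Q3 p) ‖(c : ℚ_[p])‖ with hB
  have hcδ : ‖(c : ℚ_[p])‖⁻¹ < δ := inv_lt_of_inv_lt₀ hδ ((le_max_right _ _).trans_lt hc)
  set χ : testFun p := testIndicator B (isClopen_closedBall_units 0 c) (isCompact_closedBall 0 _)
    (fun ξ => chi (pair x ξ)) (isLocallyConstant_chi.comp_continuous (continuous_pair x)) with hχ
  have h1 : fourierIntegral (fourierIntegral (φ : Q3 p → ℂ)) x =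
      ∫ ξ, fourierIntegral (φ : Q3 p → ℂ) ξ * (χ : Q3 p → ℂ) ξ ∂(haar3 p) := by
    conv_lhs => unfold fourierIntegral
    congr 1
    funext ξ
    change _ * fourierIntegral (φ : Q3 p → ℂ) ξ = _ * B.indicator _ ξ
    by_cases hξ : ξ ∈ B
    · rw [Set.indicator_of_mem hξ, mul_comm]
    · rw [image_eq_zero_of_notMem_tsupport (f := fourierIntegral (φ : Q3 p → ℂ))]
      · simp
      · intro h
        exact hξ (mem_closedBall_zero_iff.2 ((hR ξ h).trans (((le_max_left _ _).trans
          (le_max_left _ _)).trans hc.le)))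
  have h2 (y : Q3 p) : fourierIntegral (χ : Q3 p → ℂ) y =
      (Metric.closedBall 0 ‖(c : ℚ_[p])‖⁻¹).indicator
        (fun _ => ((haar3 p).real B : ℂ)) (y + x) := by
    rw [← setIntegral_chi_closedBall, ← integral_indicator measurableSet_closedBall]
    unfold fourierIntegral
    congr 1
    funext ξ
    change chi (pair y ξ) * B.indicator (fun ξ => chi (pair x ξ)) ξ = _
    by_cases hξ : ξ ∈ B
    · rw [Set.indicator_of_mem hξ, Set.indicator_of_mem hξ, pair_add_left, chi_add]
    · rw [Set.indicator_of_notMem hξ, Set.indicator_of_notMem hξ, mul_zero]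
  rw [h1, integral_fourierIntegral_mul, ← integral_add_right_eq_self _ (-x)]
  have h3 : (fun y => (φ : Q3 p → ℂ) (y + -x) * fourierIntegral (χ : Q3 p → ℂ) (y + -x)) =
      (Metric.closedBall 0 ‖(c : ℚ_[p])‖⁻¹).indicator
        (fun _ => (φ : Q3 p → ℂ) (-x) * ((haar3 p).real B : ℂ)) := by
    funext y
    rw [h2, neg_add_cancel_right]
    by_cases hy : y ∈ Metric.closedBall (0 : Q3 p) ‖(c : ℚ_[p])‖⁻¹
    · rw [Set.indicator_of_mem hy, Set.indicator_of_mem hy, add_comm, hper]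
      exact (mem_closedBall_zero_iff.1 hy).trans_lt hcδ
    · rw [Set.indicator_of_notMem hy, Set.indicator_of_notMem hy, mul_zero]
  rw [h3, integral_indicator measurableSet_closedBall, setIntegral_const]
  have h4 := congrArg ENNReal.toReal (haar3_closedBall_mul c)
  rw [ENNReal.toReal_mul, ENNReal.toReal_one] at h4
  have h5 : ((haar3 p).real B : ℂ) *
      ((haar3 p).real (Metric.closedBall 0 ‖(c : ℚ_[p])‖⁻¹) : ℂ) = 1 := by
    exact_mod_cast h4
  rw [Complex.real_smul]
  linear_combination (φ : Q3 p → ℂ) (-x) * h5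

/-- Reflection of a test function at the origin. -/
def testNeg (φ : testFun p) : testFun p :=
  ⟨fun x => (φ : Q3 p → ℂ) (-x), φ.2.1.comp_continuous continuous_neg,
    φ.2.2.comp_homeomorph (Homeomorph.neg _)⟩

/-- Complex conjugation of a test function. -/
def testConj (φ : testFun p) : testFun p :=
  ⟨fun x => conj ((φ : Q3 p → ℂ) x), φ.2.1.comp _,
    φ.2.2.comp_left (g := fun z : ℂ => conj z) (map_zero _)⟩

theorem conj_fourierIntegral (φ : testFun p) (ξ : Q3 p) :
    conj (fourierIntegral (φ : Q3 p → ℂ) ξ) =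
      fourierIntegral (testNeg (testConj φ) : Q3 p → ℂ) ξ := by
  unfold fourierIntegral
  rw [← integral_conj, ← integral_neg_eq_self]
  congr 1
  funext x
  rw [map_mul, conj_chi, pair_neg, neg_neg]
  rfl

/-- Parseval's identity. -/
theorem integral_conj_fourierIntegral_mul (φ ψ : testFun p) :
    ∫ ξ, conj (fourierIntegral (φ : Q3 p → ℂ) ξ) * fourierIntegral (ψ : Q3 p → ℂ) ξ ∂(haar3 p) =
      ∫ x, conj ((φ : Q3 p → ℂ) x) * (ψ : Q3 p → ℂ) x ∂(haar3 p) := by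
  simp only [conj_fourierIntegral]
  refine (integral_fourierIntegral_mul (testNeg (testConj φ)) (fourierTest p ψ)).trans ?_
  rw [← integral_neg_eq_self]
  congr 1
  funext x
  change conj ((φ : Q3 p → ℂ) (- -x)) * fourierIntegral (fourierIntegral (ψ : Q3 p → ℂ)) (-x) = _
  rw [fourierIntegral_fourierIntegral, neg_neg]

variable (p) in
/-- The Fourier transform of test functions as a linear bijection. -/
def fourierTestEquiv : testFun p ≃ₗ[ℂ] testFun p :=
  LinearEquiv.ofBijective (fourierTest p) (by
    -- The square of the transform is an involution, which gives both injectivity and surjectivity.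
    have h (φ : testFun p) : fourierTest p (fourierTest p φ) = testNeg φ :=
      Subtype.ext (funext fun x => fourierIntegral_fourierIntegral φ x)
    have hn (φ : testFun p) : testNeg (testNeg φ) = φ :=
      Subtype.ext (funext fun x => congrArg (φ : Q3 p → ℂ) (neg_neg x))
    constructor
    · intro φ ψ hφ
      rw [← hn φ, ← h φ, hφ, h, hn]
    · intro ψ
      exact ⟨fourierTest p (testNeg ψ), by rw [h, hn]⟩)

theorem inner_testToL2 (φ ψ : testFun p) :
    ⟪testToL2 p φ, testToL2 p ψ⟫_ℂ =
      ∫ x, conj ((φ : Q3 p → ℂ) x) * (ψ : Q3 p → ℂ) x ∂(haar3 p) := by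
  rw [L2.inner_def]
  refine integral_congr_ae ?_
  filter_upwards [(testFun_memLp φ).coeFn_toLp, (testFun_memLp ψ).coeFn_toLp] with x h1 h2
  change inner ℂ ((testFun_memLp φ).toLp _ x) ((testFun_memLp ψ).toLp _ x) = _
  rw [h1, h2, RCLike.inner_apply, mul_comm]

theorem norm_testToL2_fourierTest (φ : testFun p) :
    ‖testToL2 p (fourierTestEquiv p φ)‖ = ‖testToL2 p φ‖ := by
  have h : ⟪testToL2 p (fourierTestEquiv p φ), testToL2 p (fourierTestEquiv p φ)⟫_ℂ =
      ⟪testToL2 p φ, testToL2 p φ⟫_ℂ := by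
    rw [inner_testToL2, inner_testToL2]
    exact integral_conj_fourierIntegral_mul φ φ
  rw [inner_self_eq_norm_sq_to_K, inner_self_eq_norm_sq_to_K] at h
  have h' : ‖testToL2 p (fourierTestEquiv p φ)‖ ^ 2 = ‖testToL2 p φ‖ ^ 2 := by exact_mod_cast h
  exact (sq_eq_sq₀ (norm_nonneg _) (norm_nonneg _)).1 h'

/-- Ultrametric balls are both clopen and compact, and finitely many of them inside `U` cover `K`.
-/
theorem exists_isClopen_isCompact_between {K U : Set (Q3 p)} (hK : IsCompact K) (hU : IsOpen U)
    (hKU : K ⊆ U) : ∃ C, IsClopen C ∧ IsCompact C ∧ K ⊆ C ∧ C ⊆ U := by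
  refine hK.induction_on (p := fun s => ∃ C, IsClopen C ∧ IsCompact C ∧ s ⊆ C ∧ C ⊆ U)
    ⟨∅, isClopen_empty, isCompact_empty, le_rfl, Set.empty_subset _⟩
    (fun s t hst ⟨C, h1, h2, h3, h4⟩ => ⟨C, h1, h2, hst.trans h3, h4⟩)
    (fun s t ⟨C, h1, h2, h3, h4⟩ ⟨D, g1, g2, g3, g4⟩ => ⟨C ∪ D, h1.union g1, h2.union g2,
      Set.union_subset_union h3 g3, Set.union_subset h4 g4⟩) fun x hx => ?_
  obtain ⟨r, hr, hrU⟩ := Metric.nhds_basis_closedBall.mem_iff.1 (hU.mem_nhds (hKU hx))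
  exact ⟨Metric.closedBall x r, mem_nhdsWithin_of_mem_nhds (Metric.closedBall_mem_nhds x hr),
    Metric.closedBall x r, IsUltrametricDist.isClopen_closedBall x hr.ne',
    isCompact_closedBall x r, le_rfl, hrU⟩

/-- It suffices to approximate indicators of sets `s` of finite measure. By regularity there are `K
⊆ s ⊆ U` with small gaps; a compact clopen set between `K` and `U` has a test function as indicator,
and the error lives on the gaps. -/
theorem denseRange_testToL2 : DenseRange (testToL2 p) := by
  intro f
  rw [EMetric.mem_closure_iff]
  intro ε hε
  obtain ⟨ε', hε', hlt⟩ := exists_between hε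
  have h0 : ∀ (c : ℂ) ⦃s : Set (Q3 p)⦄, MeasurableSet s → haar3 p s < ∞ → ∀ {η : ℝ≥0∞}, η ≠ 0 →
      ∃ g : Q3 p → ℂ, eLpNorm (g - s.indicator fun _ => c) 2 (haar3 p) ≤ η ∧ g ∈ testFun p := by
    intro c s hs hμs η hη
    obtain ⟨θ, hθ, hθs⟩ := exists_eLpNorm_indicator_le (μ := haar3 p) (p := 2) (by simp) c hη
    have hθ2 : ((θ / 2 : NNReal) : ℝ≥0∞) ≠ 0 := by
      have : 0 < θ / 2 := by positivity
      exact_mod_cast this.ne'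
    obtain ⟨K, hKs, hK, hKμ⟩ := hs.exists_isCompact_sdiff_lt hμs.ne hθ2
    obtain ⟨U, hsU, hU, hUμ, hUμ'⟩ := hs.exists_isOpen_sdiff_lt hμs.ne hθ2
    obtain ⟨C, hC, hCK, hKC, hCU⟩ := exists_isClopen_isCompact_between hK hU (hKs.trans hsU)
    refine ⟨C.indicator fun _ => c,
      ?_, (testIndicator C hC hCK (fun _ => c) (IsLocallyConstant.const c)).2⟩
    refine le_trans ?_ (hθs (s \ K ∪ U \ s) ?_)
    · refine eLpNorm_mono fun x => ?_
      rw [Pi.sub_apply]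
      by_cases h1 : x ∈ C <;> by_cases h2 : x ∈ s
      · simp [h1, h2]
      · have : x ∈ s \ K ∪ U \ s := Or.inr ⟨hCU h1, h2⟩
        simp [h1, h2, this]
      · have : x ∈ s \ K ∪ U \ s := Or.inl ⟨h2, fun h => h1 (hKC h)⟩
        simp [h1, h2, this]
      · simp [h1, h2]
    · calc haar3 p (s \ K ∪ U \ s) ≤ haar3 p (s \ K) + haar3 p (U \ s) := measure_union_le _ _
        _ ≤ ((θ / 2 : NNReal) : ℝ≥0∞) + ((θ / 2 : NNReal) : ℝ≥0∞) := add_le_add hKμ.le hUμ'.le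
        _ = θ := by rw [← ENNReal.coe_add, add_halves]
  obtain ⟨g, hg, hgP⟩ := MemLp.induction_dense (μ := haar3 p) (p := 2) (by simp)
    (fun g : Q3 p → ℂ => g ∈ testFun p) h0 (fun f g hf hg => Submodule.add_mem _ hf hg)
    (fun f hf => (testFun_continuous ⟨f, hf⟩).aestronglyMeasurable) (Lp.memLp f) hε'.ne'
  refine ⟨testToL2 p ⟨g, hgP⟩, ⟨_, rfl⟩, ?_⟩
  rw [Lp.edist_def]
  refine lt_of_le_of_lt ?_ hlt
  refine le_trans (le_of_eq (eLpNorm_congr_ae ?_)) hg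
  filter_upwards [(testFun_memLp ⟨g, hgP⟩).coeFn_toLp] with x hx
  change f x - (testFun_memLp ⟨g, hgP⟩).toLp _ x = f x - g x
  rw [hx]

variable (p) in
/-- The Fourier transform of `L²(ℚ_p³)` as a unitary operator. -/
def fourierUnitary : L2 p ≃ₗᵢ[ℂ] L2 p :=
  (fourierTestEquiv p).extendOfIsometry (testToL2 p) (testToL2 p)
    denseRange_testToL2 denseRange_testToL2 norm_testToL2_fourierTest

/-- Links the extension used in the definition of the operators with the unitary one. In particular
`ContinuousLinearMap.inverse`, which is zero on non-invertible maps, is a genuine inverse here. -/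
theorem fourierL2_eq : fourierL2 p = (fourierUnitary p).toContinuousLinearEquiv := rfl

theorem fourierL2_apply (f : L2 p) : fourierL2 p f = fourierUnitary p f := rfl

theorem fourierL2_inverse_apply (f : L2 p) :
    (fourierL2 p).inverse f = (fourierUnitary p).symm f := by
  rw [fourierL2_eq, ContinuousLinearMap.inverse_equiv]
  rfl

theorem fourierUnitary_symm_mem_range {f : L2 p} (hf : f ∈ LinearMap.range (testToL2 p)) :
    (fourierUnitary p).symm f ∈ LinearMap.range (testToL2 p) := by
  obtain ⟨φ, rfl⟩ := hf
  exact ⟨(fourierTestEquiv p).symm φ,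
    ((fourierTestEquiv p).extendOfIsometry_symm_eq _ _ _ _ norm_testToL2_fourierTest φ).symm⟩

theorem fourierUnitary_mem_range {f : L2 p} (hf : f ∈ LinearMap.range (testToL2 p)) :
    fourierUnitary p f ∈ LinearMap.range (testToL2 p) := by
  obtain ⟨φ, rfl⟩ := hf
  exact ⟨fourierTestEquiv p φ,
    ((fourierTestEquiv p).extendOfIsometry_eq _ _ _ _ norm_testToL2_fourierTest φ).symm⟩

end FourierInversion

/-! ### Abstract criteria for self-adjointness, cores and spectral points. -/

section UnboundedOperators

variable {E : Type*} [NormedAddCommGroup E] [InnerProductSpace ℂ E]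

/-- A densely defined symmetric operator `A` for which `A - z` and `A - z̄` are surjective is
self-adjoint. -/
theorem isSelfAdjoint_of_surjective [CompleteSpace E] {A : E →ₗ.[ℂ] E}
    (hd : Dense (A.domain : Set E)) (hs : A.IsFormalAdjoint A) (z : ℂ)
    (h1 : ∀ y, ∃ x : A.domain, A x - z • (x : E) = y)
    (h2 : ∀ y, ∃ x : A.domain, A x - conj z • (x : E) = y) : IsSelfAdjoint A := by
  have hle : A ≤ A.adjoint := hs.le_adjoint hd
  refine (LinearPMap.isSelfAdjoint_def).2 (le_antisymm ?_ hle)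
  refine LinearPMap.le_of_le_graph fun q hq => ?_
  obtain ⟨y, hy1, hy2⟩ := (LinearPMap.mem_graph_iff _).1 hq
  -- For `y` in the adjoint domain, choose $x$ with $(A-z)x=(A^*-z)y$ and $u$ with $(A-\bar
  -- z)u=y-x$. Then $\|y-x\|^2=\langle (A^*-z)y-(A-z)x,u\rangle=0$, so `y` lies in the domain of
  -- `A`.
  obtain ⟨x, hx⟩ := h1 (A.adjoint y - z • (y : E))
  obtain ⟨u, hu⟩ := h2 ((y : E) - x)
  have e1 : ⟪(y : E), A u⟫_ℂ = ⟪A.adjoint y, (u : E)⟫_ℂ :=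
    (LinearPMap.adjoint_isFormalAdjoint hd y u).symm
  have e2 : ⟪(x : E), A u⟫_ℂ = ⟪A x, (u : E)⟫_ℂ := (hs x u).symm
  have h0 : ⟪(y : E) - x, (y : E) - x⟫_ℂ = 0 := by
    have : ⟪(y : E) - x, A u - conj z • (u : E)⟫_ℂ =
        ⟪(A.adjoint y - z • (y : E)) - (A x - z • (x : E)), (u : E)⟫_ℂ := by
      simp only [inner_sub_left, inner_sub_right, inner_smul_left, inner_smul_right, e1, e2]
      ring
    rw [hu, hx, sub_self, inner_zero_left] at this
    exact this
  have hxy : (y : E) = x := sub_eq_zero.1 (inner_self_eq_zero.1 h0)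
  have hA : A.adjoint y = A x := by
    rw [← hle.2 hxy.symm]
  refine (LinearPMap.mem_graph_iff _).2 ⟨x, hxy.symm.trans hy1, hA.symm.trans hy2⟩

theorem exists_sub_smul_eq_of_mem_resolventSet {A : E →ₗ.[ℂ] E} {z : ℂ}
    (hz : z ∈ unboundedResolventSet A) (y : E) : ∃ x : A.domain, A x - z • (x : E) = y := by
  obtain ⟨R, hR, -⟩ := hz
  obtain ⟨x, -, hx⟩ := hR y
  exact ⟨x, hx⟩

/-- The restriction of a self-adjoint operator to a core is essentially self-adjoint. -/
theorem isEssentiallySelfAdjoint_of_le [CompleteSpace E] {A T : E →ₗ.[ℂ] E}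
    (hA : IsSelfAdjoint A) (hs : A.IsFormalAdjoint A) (hT : Dense (T.domain : Set E)) (hTA : T ≤ A)
    (hcore : A.graph ≤ T.graph.topologicalClosure) : IsEssentiallySelfAdjoint T := by
  have hc : A.IsClosed := hA.isClosed
  have hTc : T.IsClosable := hc.isClosable.leIsClosable hTA
  have heq : T.closure = A := by
    refine LinearPMap.eq_of_eq_graph (le_antisymm ?_ ?_)
    · rw [← hTc.graph_closure_eq_closure_graph]
      exact Submodule.topologicalClosure_minimal _ (LinearPMap.le_graph_of_le hTA) hc
    · rwa [← hTc.graph_closure_eq_closure_graph]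
  refine ⟨hT, fun x y => ?_, hTc, heq.symm ▸ hA⟩
  have hx := hTA.2 (x := x) (y := ⟨x, hTA.1 x.2⟩) rfl
  have hy := hTA.2 (x := y) (y := ⟨y, hTA.1 y.2⟩) rfl
  rw [hx, hy]
  exact hs ⟨x, hTA.1 x.2⟩ ⟨y, hTA.1 y.2⟩

/-- A point for which there are approximate eigenvectors does not belong to the resolvent set. -/
theorem notMem_resolventSet_of_approx {A : E →ₗ.[ℂ] E} {z : ℂ}
    (h : ∀ ε > 0, ∃ x : A.domain, (x : E) ≠ 0 ∧ ‖A x - z • (x : E)‖ ≤ ε * ‖(x : E)‖) :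
    z ∉ unboundedResolventSet A := by
  rintro ⟨R, -, hR⟩
  have hpos : 0 < ‖R‖ + 1 := by positivity
  -- This tolerance makes `‖R‖ * ε < 1`, which contradicts `x = R (A x - z • x)` for `x ≠ 0`.
  obtain ⟨x, hx0, hx⟩ := h (‖R‖ + 1)⁻¹ (by positivity)
  have h1 : ‖(x : E)‖ ≤ ‖R‖ * ((‖R‖ + 1)⁻¹ * ‖(x : E)‖) := by
    conv_lhs => rw [← hR x]
    exact (R.le_opNorm _).trans (by gcongr)
  have h2 : 0 < ‖(x : E)‖ := norm_pos_iff.2 hx0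
  have h3 : ‖R‖ * ((‖R‖ + 1)⁻¹ * ‖(x : E)‖) = ‖(x : E)‖ - (‖R‖ + 1)⁻¹ * ‖(x : E)‖ := by
    field_simp
    ring
  have h4 : 0 < (‖R‖ + 1)⁻¹ * ‖(x : E)‖ := by positivity
  linarith

end UnboundedOperators

/-! ### Matrix multipliers on spinors, and test spinors inside $H^1$. -/

section Multipliers

variable {p : ℕ} [Fact p.Prime]

theorem coeFn_sum_ae {ι : Type*} (s : Finset ι) {f : ι → L2 p} {g : ι → Q3 p → ℂ}
    (h : ∀ i ∈ s, f i =ᵐ[haar3 p] g i) :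
    (∑ i ∈ s, f i : L2 p) =ᵐ[haar3 p] fun ξ => ∑ i ∈ s, g i ξ := by
  classical
  induction s using Finset.induction_on with
  | empty =>
    simp only [Finset.sum_empty]
    exact Lp.coeFn_zero _ _ _
  | insert a s ha ih =>
    simp only [Finset.sum_insert ha]
    filter_upwards [Lp.coeFn_add (f a) (∑ i ∈ s, f i), h a (Finset.mem_insert_self a s),
      ih fun i hi => h i (Finset.mem_insert_of_mem hi)] with ξ h1 h2 h3
    rw [h1, Pi.add_apply, h2, h3]

theorem coeFn_smul_ae (c : ℂ) {f : L2 p} {g : Q3 p → ℂ} (h : f =ᵐ[haar3 p] g) :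
    (c • f : L2 p) =ᵐ[haar3 p] fun ξ => c * g ξ := by
  filter_upwards [Lp.coeFn_smul c f, h] with ξ h1 h2
  rw [h1, Pi.smul_apply, h2, smul_eq_mul]

theorem coeFn_add_ae {f f' : L2 p} {g g' : Q3 p → ℂ} (h : f =ᵐ[haar3 p] g)
    (h' : f' =ᵐ[haar3 p] g') : (f + f' : L2 p) =ᵐ[haar3 p] fun ξ => g ξ + g' ξ := by
  filter_upwards [Lp.coeFn_add f f', h, h'] with ξ h1 h2 h3
  rw [h1, Pi.add_apply, h2, h3]

/-- Multiplication by an essentially bounded function on `L²(ℚ_p³)`. -/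
def boundedMul (b : Q3 p → ℂ) (hb : MemLp b ∞ (haar3 p)) : L2 p →L[ℂ] L2 p :=
  (ContinuousLinearMap.mul ℂ ℂ).holderL (haar3 p) ∞ 2 2 (hb.toLp b)

theorem boundedMul_ae (b : Q3 p → ℂ) (hb : MemLp b ∞ (haar3 p)) (f : L2 p) :
    boundedMul b hb f =ᵐ[haar3 p] fun ξ => b ξ * f ξ := by
  filter_upwards [(ContinuousLinearMap.mul ℂ ℂ).coeFn_holder (r := 2) (hb.toLp b) f,
    hb.coeFn_toLp] with ξ h1 h2
  refine Eq.trans h1 ?_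
  rw [h2, ContinuousLinearMap.mul_apply']

/-- Multiplication by a matrix of essentially bounded functions on spinors. -/
def matrixMul (B : Q3 p → Matrix (Fin 4) (Fin 4) ℂ)
    (hB : ∀ i j, MemLp (fun ξ => B ξ i j) ∞ (haar3 p)) : SpinorSpace p →L[ℂ] SpinorSpace p :=
  (PiLp.continuousLinearEquiv 2 ℂ fun _ : Fin 4 => L2 p).symm.toContinuousLinearMap ∘L
    ContinuousLinearMap.pi fun i => ∑ j, boundedMul (fun ξ => B ξ i j) (hB i j) ∘L
      PiLp.proj 2 (fun _ : Fin 4 => L2 p) j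

theorem matrixMul_ae (B : Q3 p → Matrix (Fin 4) (Fin 4) ℂ)
    (hB : ∀ i j, MemLp (fun ξ => B ξ i j) ∞ (haar3 p)) (h : SpinorSpace p) (i : Fin 4) :
    matrixMul B hB h i =ᵐ[haar3 p] fun ξ => ∑ j, B ξ i j * h j ξ := by
  have e : matrixMul B hB h i = ∑ j, boundedMul (fun ξ => B ξ i j) (hB i j) (h j) := by
    simp [matrixMul]
  rw [e]
  exact coeFn_sum_ae _ fun j _ => boundedMul_ae _ _ _

/-- The unbounded weight is absorbed into the matrix entries. This is how images of multipliers are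
shown to lie in $H^1$. -/
theorem memLp_weight_matrixMul (w : Q3 p → ℂ) (B : Q3 p → Matrix (Fin 4) (Fin 4) ℂ)
    (hB : ∀ i j, MemLp (fun ξ => B ξ i j) ∞ (haar3 p))
    (hw : ∀ i j, MemLp (fun ξ => w ξ * B ξ i j) ∞ (haar3 p)) (h : SpinorSpace p) (i : Fin 4) :
    MemLp (fun ξ => w ξ * matrixMul B hB h i ξ) 2 (haar3 p) := by
  have h1 : MemLp (fun ξ => ∑ j, w ξ * B ξ i j * h j ξ) 2 (haar3 p) :=
    memLp_finsetSum _ fun j _ => (Lp.memLp (h j)).mul (hw i j)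
  refine (memLp_congr_ae ?_).1 h1
  filter_upwards [matrixMul_ae B hB h i] with ξ hξ
  rw [hξ, Finset.mul_sum]
  exact Finset.sum_congr rfl fun j _ => mul_assoc _ _ _

variable (p) in
/-- The Fourier transform of spinors. -/
def fourierSpinor : SpinorSpace p ≃ₗᵢ[ℂ] SpinorSpace p :=
  LinearIsometryEquiv.piLpCongrRight 2 fun _ => fourierUnitary p

theorem spinor_ext_ae {φ ψ : SpinorSpace p} (h : ∀ i, φ i =ᵐ[haar3 p] ψ i) : φ = ψ := by
  ext1 i
  exact Lp.ext (h i)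

theorem dense_testSpinors : Dense (testSpinors p : Set (SpinorSpace p)) := by
  have h : Dense (Set.univ.pi fun _ : Fin 4 => (LinearMap.range (testToL2 p) : Set (L2 p))) :=
    dense_pi _ fun _ _ => denseRange_testToL2
  have := h.preimage (PiLp.continuousLinearEquiv 2 ℂ fun _ : Fin 4 => L2 p).toHomeomorph.isOpenMap
  refine this.mono fun ψ hψ i => ?_
  exact hψ i (Set.mem_univ i)

theorem mem_sobolevH1_iff {ψ : SpinorSpace p} : ψ ∈ sobolevH1 p ↔ ∀ i,
    MemLp (fun ξ => ((max 1 ‖ξ‖ : ℝ) : ℂ) * fourierSpinor p ψ i ξ) 2 (haar3 p) := Iff.rfl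

/-- The norm fails to be locally constant only at the origin, where the maximum with 1 flattens it.
Hence division by the weight preserves test functions. -/
theorem isLocallyConstant_max_one_norm : IsLocallyConstant fun ξ : Q3 p => max 1 ‖ξ‖ := by
  rw [IsLocallyConstant.iff_eventually_eq]
  intro x
  filter_upwards [Metric.closedBall_mem_nhds x one_pos] with y hy
  rw [mem_closedBall_iff_norm] at hy
  have h (a b : Q3 p) (hab : ‖a - b‖ ≤ 1) : max 1 ‖a‖ ≤ max 1 ‖b‖ := by
    refine max_le (le_max_left _ _) ?_
    have := IsUltrametricDist.norm_add_le_max (a - b) b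
    rw [sub_add_cancel] at this
    exact this.trans (max_le_max_right _ hab)
  exact le_antisymm (h _ _ hy) (h _ _ (by rwa [norm_sub_rev]))

theorem testSpinors_le_sobolevH1 : testSpinors p ≤ sobolevH1 p := by
  intro ψ hψ i
  obtain ⟨φ, hφ⟩ := fourierUnitary_mem_range (hψ i)
  have hc : Continuous fun ξ : Q3 p => ((max 1 ‖ξ‖ : ℝ) : ℂ) * (φ : Q3 p → ℂ) ξ := by
    have := testFun_continuous φ
    fun_prop
  refine (memLp_congr_ae ?_).1 (hc.memLp_of_hasCompactSupport φ.2.2.mul_left)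
  filter_upwards [(testFun_memLp φ).coeFn_toLp] with ξ hξ
  rw [fourierL2_apply, ← hφ]
  change _ = _ * (testFun_memLp φ).toLp _ ξ
  rw [hξ]

end Multipliers

/-! ### The matrix symbol, its square, and its size relative to the Sobolev weight. -/

section Symbol

variable {p : ℕ} [Fact p.Prime]

/-- The symbol `∑_k |ξ_k|_p α_k + m β` of the free Dirac operator. -/
def diracSymbol (m : ℝ) (ξ : Q3 p) : Matrix (Fin 4) (Fin 4) ℂ :=
  ∑ k : Fin 3, (‖ξ k‖ : ℂ) • diracAlpha k + (m : ℂ) • diracBeta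

theorem diracSymbol_eq (m : ℝ) (ξ : Q3 p) : diracSymbol m ξ =
    !![(m : ℂ), 0, ‖ξ 2‖, ‖ξ 0‖ - Complex.I * ‖ξ 1‖;
      0, m, ‖ξ 0‖ + Complex.I * ‖ξ 1‖, -‖ξ 2‖;
      ‖ξ 2‖, ‖ξ 0‖ - Complex.I * ‖ξ 1‖, -m, 0;
      ‖ξ 0‖ + Complex.I * ‖ξ 1‖, -‖ξ 2‖, 0, -m] := by
  have h0 : (finSumFinEquiv (m := 2) (n := 2)).symm 0 = Sum.inl 0 := rfl
  have h1 : (finSumFinEquiv (m := 2) (n := 2)).symm 1 = Sum.inl 1 := rfl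
  have h2 : (finSumFinEquiv (m := 2) (n := 2)).symm 2 = Sum.inr 0 := rfl
  have h3 : (finSumFinEquiv (m := 2) (n := 2)).symm 3 = Sum.inr 1 := rfl
  ext i j
  fin_cases i <;> fin_cases j <;>
    simp [diracSymbol, diracAlpha, diracBeta, pauli, Fin.sum_univ_three, h0, h1, h2, h3] <;> ring

theorem diracSymbol_isHermitian (m : ℝ) (ξ : Q3 p) : (diracSymbol m ξ).IsHermitian := by
  rw [diracSymbol_eq]
  ext i j
  fin_cases i <;> fin_cases j <;> simp [Matrix.conjTranspose_apply] <;> ring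

theorem energy_sq (m : ℝ) (ξ : Q3 p) :
    energy p m ξ ^ 2 = ∑ k : Fin 3, ‖ξ k‖ ^ 2 + m ^ 2 :=
  Real.sq_sqrt (by positivity)

/-- The Clifford relations of the Dirac matrices, checked entrywise. -/
theorem diracSymbol_mul_self (m : ℝ) (ξ : Q3 p) :
    diracSymbol m ξ * diracSymbol m ξ = ((energy p m ξ : ℂ) ^ 2) • 1 := by
  have h : (energy p m ξ : ℂ) ^ 2 =
      (‖ξ 0‖ : ℂ) ^ 2 + (‖ξ 1‖ : ℂ) ^ 2 + (‖ξ 2‖ : ℂ) ^ 2 + (m : ℂ) ^ 2 := by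
    have := energy_sq m ξ
    rw [Fin.sum_univ_three] at this
    exact_mod_cast this
  rw [h, diracSymbol_eq]
  have hI := Complex.I_sq
  ext i j
  fin_cases i <;> fin_cases j <;>
    simp [Matrix.mul_apply, Fin.sum_univ_four] <;>
    first | ring1 | linear_combination (-‖ξ 1‖ ^ 2 : ℂ) * hI

theorem energy_nonneg (m : ℝ) (ξ : Q3 p) : 0 ≤ energy p m ξ := Real.sqrt_nonneg _

/-- As $A$ is Hermitian, the $i$-th diagonal entry of $A^2=\lambda^2$ says
$\sum_j|A_{ij}|^2=\lambda^2$. -/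
theorem norm_diracSymbol_apply_le (m : ℝ) (ξ : Q3 p) (i j : Fin 4) :
    ‖diracSymbol m ξ i j‖ ≤ energy p m ξ := by
  refine abs_le_of_sq_le_sq' ?_ (energy_nonneg m ξ) |>.2
  have h := congrFun (congrFun (diracSymbol_mul_self m ξ) i) i
  rw [Matrix.mul_apply] at h
  have h2 : ∑ j, ‖diracSymbol m ξ i j‖ ^ 2 = energy p m ξ ^ 2 := by
    have h3 : ((∑ j, ‖diracSymbol m ξ i j‖ ^ 2 : ℝ) : ℂ) = ((energy p m ξ ^ 2 : ℝ) : ℂ) := by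
      push_cast
      rw [Matrix.smul_apply, Matrix.one_apply_eq, smul_eq_mul, mul_one] at h
      rw [← h]
      refine Finset.sum_congr rfl fun k _ => ?_
      rw [← (diracSymbol_isHermitian m ξ).apply k i, ← Complex.mul_conj']
      rfl
    exact_mod_cast h3
  rw [← h2]
  exact Finset.single_le_sum (f := fun j => ‖diracSymbol m ξ i j‖ ^ 2)
    (fun _ _ => by positivity) (Finset.mem_univ j)

theorem max_one_norm_le_energy (m : ℝ) (ξ : Q3 p) : max 1 ‖ξ‖ ≤ 1 + energy p m ξ := by
  refine max_le (by linarith [energy_nonneg m ξ]) ?_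
  have h : ‖ξ‖ ≤ energy p m ξ := by
    refine (pi_norm_le_iff_of_nonneg (energy_nonneg m ξ)).2 fun k => ?_
    refine abs_le_of_sq_le_sq' ?_ (energy_nonneg m ξ) |>.2
    rw [energy_sq]
    have := Finset.single_le_sum (f := fun k => ‖ξ k‖ ^ 2) (fun _ _ => by positivity)
      (Finset.mem_univ k)
    have hm := sq_nonneg m
    linarith
  linarith

/-- The three coordinates and the mass give $\lambda^2\le(3+m^2)\max(1,\|\xi\|)^2$, and
$3+m^2\le(2+|m|)^2$. -/
theorem energy_le_max_one_norm (m : ℝ) (ξ : Q3 p) : energy p m ξ ≤ (2 + |m|) * max 1 ‖ξ‖ := by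
  have h0 : 1 ≤ max 1 ‖ξ‖ := le_max_left _ _
  refine abs_le_of_sq_le_sq' ?_ (by positivity) |>.2
  rw [energy_sq, Fin.sum_univ_three]
  have h (k : Fin 3) : ‖ξ k‖ ^ 2 ≤ max 1 ‖ξ‖ ^ 2 := by
    gcongr
    exact (norm_le_pi_norm ξ k).trans (le_max_right _ _)
  have hm : m ^ 2 ≤ |m| ^ 2 * max 1 ‖ξ‖ ^ 2 := by
    rw [sq_abs]
    exact le_mul_of_one_le_right (sq_nonneg m) (one_le_pow₀ h0)
  have h4 : 0 ≤ |m| * max 1 ‖ξ‖ ^ 2 := by positivity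
  nlinarith [h 0, h 1, h 2, sq_nonneg (max 1 ‖ξ‖)]

theorem continuous_diracSymbol (m : ℝ) : Continuous (diracSymbol (p := p) m) := by
  unfold diracSymbol
  fun_prop

theorem continuous_energy (m : ℝ) : Continuous (energy p m) := by
  unfold energy
  fun_prop

end Symbol

/-! ### The Dirac operator in the Fourier picture: multiplication by the symbol, and symmetry. -/

section DiracOperator

variable {p : ℕ} [Fact p.Prime]

/-- The value of a spinor at a point. -/
def spinorAt (ψ : SpinorSpace p) (ξ : Q3 p) : Fin 4 → ℂ := fun i => ψ i ξ

theorem eq_of_spinorAt_ae {φ ψ : SpinorSpace p}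
    (h : ∀ᵐ ξ ∂(haar3 p), spinorAt φ ξ = spinorAt ψ ξ) : φ = ψ :=
  spinor_ext_ae fun i => h.mono fun _ hξ => congrFun hξ i

theorem spinorAt_sub_smul (φ ψ : SpinorSpace p) (z : ℂ) :
    ∀ᵐ ξ ∂(haar3 p), spinorAt (φ - z • ψ) ξ = spinorAt φ ξ - z • spinorAt ψ ξ := by
  have h (i : Fin 4) : ∀ᵐ ξ ∂(haar3 p), (φ - z • ψ) i ξ = φ i ξ - z * ψ i ξ := by
    filter_upwards [Lp.coeFn_sub (φ i) (z • ψ i), Lp.coeFn_smul z (ψ i)] with ξ h1 h2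
    refine Eq.trans h1 ?_
    rw [Pi.sub_apply, h2, Pi.smul_apply, smul_eq_mul]
  filter_upwards [ae_all_iff.2 h] with ξ hξ
  funext i
  exact hξ i

theorem spinorAt_matrixMul (B : Q3 p → Matrix (Fin 4) (Fin 4) ℂ)
    (hB : ∀ i j, MemLp (fun ξ => B ξ i j) ∞ (haar3 p)) (h : SpinorSpace p) :
    ∀ᵐ ξ ∂(haar3 p), spinorAt (matrixMul B hB h) ξ = B ξ *ᵥ spinorAt h ξ := by
  filter_upwards [ae_all_iff.2 (matrixMul_ae B hB h)] with ξ hξ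
  funext i
  exact hξ i

theorem inner_spinor (φ ψ : SpinorSpace p) :
    ⟪φ, ψ⟫_ℂ = ∫ ξ, star (spinorAt φ ξ) ⬝ᵥ spinorAt ψ ξ ∂(haar3 p) := by
  rw [PiLp.inner_apply]
  simp only [L2.inner_def]
  rw [← integral_finsetSum _ fun i _ => L2.integrable_inner (φ i) (ψ i)]
  refine integral_congr_ae (Filter.Eventually.of_forall fun ξ => ?_)
  refine Finset.sum_congr rfl fun i _ => ?_
  exact (RCLike.inner_apply _ _).trans (mul_comm _ _)

theorem norm_spinor_le {φ ψ : SpinorSpace p} {c : ℝ} (hc : 0 ≤ c)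
    (h : ∀ i, ‖φ i‖ ≤ c * ‖ψ i‖) : ‖φ‖ ≤ c * ‖ψ‖ := by
  refine abs_le_of_sq_le_sq' ?_ (by positivity) |>.2
  rw [mul_pow, PiLp.norm_sq_eq_of_L2, PiLp.norm_sq_eq_of_L2, Finset.mul_sum]
  refine Finset.sum_le_sum fun i _ => ?_
  rw [← mul_pow]
  exact pow_le_pow_left₀ (norm_nonneg _) (h i) 2

theorem fourierUnitary_pseudoDiff (w : Q3 p → ℝ) (f : (pseudoDiff p w).domain) :
    fourierUnitary p (pseudoDiff p w f) =ᵐ[haar3 p] fun ξ => (w ξ : ℂ) * fourierUnitary p f ξ := by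
  have h : pseudoDiff p w f = (fourierUnitary p).symm (weightMul p w f) :=
    fourierL2_inverse_apply _
  rw [h, LinearIsometryEquiv.apply_symm_apply]
  exact (weightDomain_memLp f).coeFn_toLp

/-- The free Dirac operator is multiplication by its symbol in the Fourier picture. -/
theorem spinorAt_freeDirac (m : ℝ) (ψ : (freeDirac p m).domain) :
    ∀ᵐ ξ ∂(haar3 p), spinorAt (fourierSpinor p (freeDirac p m ψ)) ξ =
      diracSymbol m ξ *ᵥ spinorAt (fourierSpinor p ψ) ξ := by
  have h (i : Fin 4) : ∀ᵐ ξ ∂(haar3 p), fourierUnitary p (freeDirac p m ψ i) ξ =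
      (∑ k : Fin 3, ∑ j : Fin 4, diracAlpha k i j *
        ((‖ξ k‖ : ℂ) * fourierUnitary p ((ψ : SpinorSpace p) j) ξ)) +
      ∑ j : Fin 4, (diracBeta i j * (m : ℂ)) * fourierUnitary p ((ψ : SpinorSpace p) j) ξ := by
    have e : freeDirac p m ψ i =
        (∑ k : Fin 3, ∑ j : Fin 4, diracAlpha k i j • taibleson p k (component k j ψ)) +
          ∑ j : Fin 4, (diracBeta i j * (m : ℂ)) • (ψ : SpinorSpace p) j := rfl
    rw [e]
    simp only [map_add, map_sum, map_smul]
    refine coeFn_add_ae (coeFn_sum_ae _ fun k _ => coeFn_sum_ae _ fun j _ =>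
      coeFn_smul_ae _ ?_) (coeFn_sum_ae _ fun j _ => coeFn_smul_ae _ Filter.EventuallyEq.rfl)
    exact fourierUnitary_pseudoDiff (fun ξ => ‖ξ k‖) (component k j ψ)
  filter_upwards [ae_all_iff.2 h] with ξ hξ
  funext i
  refine (hξ i).trans ?_
  rw [Finset.sum_comm, ← Finset.sum_add_distrib]
  change _ = ∑ j, diracSymbol m ξ i j * fourierUnitary p ((ψ : SpinorSpace p) j) ξ
  refine Finset.sum_congr rfl fun j _ => ?_
  simp only [diracSymbol, Fin.sum_univ_three, Matrix.add_apply, Matrix.smul_apply, smul_eq_mul]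
  ring

theorem freeDirac_isFormalAdjoint (m : ℝ) : (freeDirac p m).IsFormalAdjoint (freeDirac p m) := by
  intro φ ψ
  rw [← (fourierSpinor p).inner_map_map, ← (fourierSpinor p).inner_map_map φ, inner_spinor,
    inner_spinor]
  refine integral_congr_ae ?_
  filter_upwards [spinorAt_freeDirac m φ, spinorAt_freeDirac m ψ] with ξ h1 h2
  rw [h1, h2, Matrix.star_mulVec, (diracSymbol_isHermitian m ξ).eq, Matrix.dotProduct_mulVec]

theorem dense_freeDirac_domain (m : ℝ) :
    Dense ((freeDirac p m).domain : Set (SpinorSpace p)) :=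
  dense_testSpinors.mono testSpinors_le_sobolevH1

theorem fourierSpinor_symm_mem_sobolevH1 {g : SpinorSpace p}
    (h : ∀ i, MemLp (fun ξ => ((max 1 ‖ξ‖ : ℝ) : ℂ) * g i ξ) 2 (haar3 p)) :
    (fourierSpinor p).symm g ∈ sobolevH1 p := by
  refine mem_sobolevH1_iff.2 fun i => ?_
  rw [LinearIsometryEquiv.apply_symm_apply]
  exact h i

/-! ### The resolvent and self-adjointness on $H^1$. -/

section Resolvent

/-- The symbol `(λ² - z²)⁻¹ (A + z)` of the resolvent. -/
def resolventSymbol (m : ℝ) (z : ℂ) (ξ : Q3 p) : Matrix (Fin 4) (Fin 4) ℂ :=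
  ((energy p m ξ : ℂ) ^ 2 - z ^ 2)⁻¹ • (diracSymbol m ξ + z • 1)

theorem diracSymbol_sub_mul_resolventSymbol {m : ℝ} {z : ℂ} {ξ : Q3 p}
    (h : (energy p m ξ : ℂ) ^ 2 - z ^ 2 ≠ 0) :
    (diracSymbol m ξ - z • 1) * resolventSymbol m z ξ = 1 := by
  have e : (diracSymbol m ξ - z • 1) * (diracSymbol m ξ + z • 1) =
      ((energy p m ξ : ℂ) ^ 2 - z ^ 2) • 1 := by
    rw [sub_mul, mul_add, mul_add, diracSymbol_mul_self]
    simp only [Algebra.mul_smul_comm, Algebra.smul_mul_assoc, mul_one, one_mul, smul_smul]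
    rw [sub_smul, sq z]
    abel
  rw [resolventSymbol, Matrix.mul_smul, e, smul_smul, inv_mul_cancel₀ h, one_smul]

theorem resolventSymbol_mul_diracSymbol_sub {m : ℝ} {z : ℂ} {ξ : Q3 p}
    (h : (energy p m ξ : ℂ) ^ 2 - z ^ 2 ≠ 0) :
    resolventSymbol m z ξ * (diracSymbol m ξ - z • 1) = 1 :=
  mul_eq_one_comm.1 (diracSymbol_sub_mul_resolventSymbol h)

theorem sub_smul_one_mulVec (A : Matrix (Fin 4) (Fin 4) ℂ) (z : ℂ) (v : Fin 4 → ℂ) :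
    (A - z • 1) *ᵥ v = A *ᵥ v - z • v := by
  rw [Matrix.sub_mulVec, Matrix.smul_mulVec, Matrix.one_mulVec]

theorem aestronglyMeasurable_resolventSymbol (m : ℝ) (z : ℂ) (i j : Fin 4) :
    AEStronglyMeasurable (fun ξ => resolventSymbol m z ξ i j) (haar3 p) := by
  have h1 := continuous_energy (p := p) m
  have h2 : Continuous fun ξ : Q3 p => (diracSymbol m ξ + z • 1) i j :=
    ((continuous_diracSymbol m).add continuous_const).matrix_elem i j
  have h3 : Continuous fun ξ : Q3 p => (energy p m ξ : ℂ) ^ 2 - z ^ 2 := by fun_prop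
  exact (h3.measurable.inv.mul h2.measurable).aestronglyMeasurable

/-- The weight and the entries of $A+z$ each grow at most like $1+\lambda$, while
$\lambda^2-z^2=(\lambda-z)(\lambda+z)$ is at least $(1+\lambda)^2/K^2$ in modulus. -/
theorem norm_weight_mul_resolventSymbol_le {m K : ℝ} {z : ℂ} {ξ : Q3 p}
    (h1 : 1 + energy p m ξ ≤ K * ‖(energy p m ξ : ℂ) - z‖)
    (h2 : 1 + energy p m ξ ≤ K * ‖(energy p m ξ : ℂ) + z‖) (i j : Fin 4) :
    max 1 ‖ξ‖ * ‖resolventSymbol m z ξ i j‖ ≤ (1 + ‖z‖) * K ^ 2 := by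
  set l := energy p m ξ with hl
  have hl0 : 0 ≤ l := energy_nonneg m ξ
  have hA : ‖(diracSymbol m ξ + z • 1) i j‖ ≤ (1 + ‖z‖) * (1 + l) := by
    have : ‖(z • (1 : Matrix (Fin 4) (Fin 4) ℂ)) i j‖ ≤ ‖z‖ := by
      rw [Matrix.smul_apply, Matrix.one_apply, smul_eq_mul, norm_mul]
      split_ifs <;> simp
    calc _ ≤ ‖diracSymbol m ξ i j‖ + ‖(z • (1 : Matrix (Fin 4) (Fin 4) ℂ)) i j‖ := norm_add_le _ _
      _ ≤ l + ‖z‖ := add_le_add (norm_diracSymbol_apply_le m ξ i j) this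
      _ ≤ (1 + ‖z‖) * (1 + l) := by nlinarith [norm_nonneg z, mul_nonneg (norm_nonneg z) hl0]
  have hD : (1 + l) * (1 + l) ≤ K ^ 2 * ‖(l : ℂ) ^ 2 - z ^ 2‖ := by
    have e : (l : ℂ) ^ 2 - z ^ 2 = ((l : ℂ) - z) * ((l : ℂ) + z) := by ring
    rw [e, norm_mul]
    calc (1 + l) * (1 + l) ≤ (K * ‖(l : ℂ) - z‖) * (K * ‖(l : ℂ) + z‖) :=
          mul_le_mul h1 h2 (by positivity) (by linarith)
      _ = _ := by ring
  have hpos : 0 < ‖(l : ℂ) ^ 2 - z ^ 2‖ := by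
    rcases (norm_nonneg ((l : ℂ) ^ 2 - z ^ 2)).eq_or_lt with h | h
    · rw [← h, mul_zero] at hD
      nlinarith
    · exact h
  rw [resolventSymbol, Matrix.smul_apply, smul_eq_mul, norm_mul, norm_inv]
  calc max 1 ‖ξ‖ * (‖(l : ℂ) ^ 2 - z ^ 2‖⁻¹ * ‖(diracSymbol m ξ + z • 1) i j‖)
      ≤ (1 + l) * (‖(l : ℂ) ^ 2 - z ^ 2‖⁻¹ * ((1 + ‖z‖) * (1 + l))) := by
        gcongr
        exact max_one_norm_le_energy m ξ
    _ = (1 + ‖z‖) * ((1 + l) * (1 + l)) * ‖(l : ℂ) ^ 2 - z ^ 2‖⁻¹ := by ring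
    _ ≤ (1 + ‖z‖) * (K ^ 2 * ‖(l : ℂ) ^ 2 - z ^ 2‖) * ‖(l : ℂ) ^ 2 - z ^ 2‖⁻¹ := by gcongr
    _ = (1 + ‖z‖) * K ^ 2 := by field_simp

/-- The inverse is $\mathcal F^{-1}r\,\mathcal F$ with $r$ the resolvent symbol: boundedness of the
weighted $r$ puts its range in $H^1$, and $r$ inverts $A-z$ almost everywhere. -/
theorem mem_resolventSet_freeDirac {m ε : ℝ} {z : ℂ} (hε : 0 < ε)
    (h1 : ∀ᵐ ξ ∂(haar3 p), ε ≤ ‖(energy p m ξ : ℂ) - z‖)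
    (h2 : ∀ᵐ ξ ∂(haar3 p), ε ≤ ‖(energy p m ξ : ℂ) + z‖) :
    z ∈ unboundedResolventSet (freeDirac p m) := by
  -- A gap `ε` becomes a gap proportional to `1 + l`: one has $1+l\le|l-z|+(1+|z|)$, and the last
  -- term is at most $\frac{1+|z|}{\varepsilon}|l-z|$. The bound for $l+z$ is the case `-z`.
  have key (l : ℝ) (z : ℂ) (h : ε ≤ ‖(l : ℂ) - z‖) :
      1 + l ≤ (1 + (1 + ‖z‖) / ε) * ‖(l : ℂ) - z‖ := by
    have e1 : l ≤ ‖(l : ℂ) - z‖ + ‖z‖ := by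
      have := norm_add_le ((l : ℂ) - z) z
      rw [sub_add_cancel, Complex.norm_real] at this
      exact (le_abs_self l).trans this
    have e2 : 1 + ‖z‖ ≤ (1 + ‖z‖) / ε * ‖(l : ℂ) - z‖ := by
      rw [div_mul_eq_mul_div, le_div_iff₀ hε]
      gcongr
    linarith
  set C := (1 + ‖z‖) * (1 + (1 + ‖z‖) / ε) ^ 2 with hC
  have hne : ∀ᵐ ξ ∂(haar3 p), (energy p m ξ : ℂ) ^ 2 - z ^ 2 ≠ 0 := by
    filter_upwards [h1, h2] with ξ g1 g2
    have e : (energy p m ξ : ℂ) ^ 2 - z ^ 2 =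
      ((energy p m ξ : ℂ) - z) * ((energy p m ξ : ℂ) + z) := by ring
    rw [e]
    exact mul_ne_zero (norm_pos_iff.1 (hε.trans_le g1)) (norm_pos_iff.1 (hε.trans_le g2))
  have hb : ∀ᵐ ξ ∂(haar3 p), ∀ i j, max 1 ‖ξ‖ * ‖resolventSymbol m z ξ i j‖ ≤ C := by
    filter_upwards [h1, h2] with ξ g1 g2 i j
    refine norm_weight_mul_resolventSymbol_le (key _ _ g1) ?_ i j
    have := key (energy p m ξ) (-z) (by rwa [sub_neg_eq_add])
    rwa [sub_neg_eq_add, norm_neg] at this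
  have hr (i j : Fin 4) : MemLp (fun ξ => resolventSymbol m z ξ i j) ∞ (haar3 p) := by
    refine memLp_top_of_bound (aestronglyMeasurable_resolventSymbol m z i j) C ?_
    filter_upwards [hb] with ξ hξ
    exact (le_mul_of_one_le_left (norm_nonneg _) (le_max_left _ _)).trans (hξ i j)
  have hwr (i j : Fin 4) :
      MemLp (fun ξ => ((max 1 ‖ξ‖ : ℝ) : ℂ) * resolventSymbol m z ξ i j) ∞ (haar3 p) := by
    have hw : Continuous fun ξ : Q3 p => ((max 1 ‖ξ‖ : ℝ) : ℂ) := by fun_prop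
    refine memLp_top_of_bound (hw.aestronglyMeasurable.mul
      (aestronglyMeasurable_resolventSymbol m z i j)) C ?_
    filter_upwards [hb] with ξ hξ
    rw [norm_mul, Complex.norm_real, Real.norm_of_nonneg (by positivity)]
    exact hξ i j
  refine ⟨(fourierSpinor p).symm.toContinuousLinearEquiv.toContinuousLinearMap ∘L
    matrixMul _ hr ∘L (fourierSpinor p).toContinuousLinearEquiv.toContinuousLinearMap,
    fun y => ?_, fun x => ?_⟩
  · set g := matrixMul _ hr (fourierSpinor p y) with hg
    refine ⟨⟨(fourierSpinor p).symm g, fourierSpinor_symm_mem_sobolevH1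
      (memLp_weight_matrixMul _ _ hr hwr _)⟩, rfl, ?_⟩
    refine (fourierSpinor p).injective (eq_of_spinorAt_ae ?_)
    rw [map_sub, map_smul]
    filter_upwards [hne, spinorAt_sub_smul (fourierSpinor p (freeDirac p m
      ⟨(fourierSpinor p).symm g, fourierSpinor_symm_mem_sobolevH1
      (memLp_weight_matrixMul _ _ hr hwr _)⟩)) (fourierSpinor p ((fourierSpinor p).symm g)) z,
      spinorAt_freeDirac m ⟨(fourierSpinor p).symm g, fourierSpinor_symm_mem_sobolevH1
      (memLp_weight_matrixMul _ _ hr hwr _)⟩, spinorAt_matrixMul _ hr (fourierSpinor p y)]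
      with ξ e0 e1 e2 e3
    refine e1.trans ?_
    rw [e2]
    simp only [LinearIsometryEquiv.apply_symm_apply]
    rw [e3, ← sub_smul_one_mulVec, Matrix.mulVec_mulVec, diracSymbol_sub_mul_resolventSymbol e0,
      Matrix.one_mulVec]
  · refine (fourierSpinor p).injective (eq_of_spinorAt_ae ?_)
    change ∀ᵐ ξ ∂(haar3 p), spinorAt (fourierSpinor p ((fourierSpinor p).symm (matrixMul _ hr
      (fourierSpinor p (freeDirac p m x - z • (x : SpinorSpace p)))))) ξ = _
    rw [LinearIsometryEquiv.apply_symm_apply, map_sub, map_smul]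
    filter_upwards [hne, spinorAt_sub_smul (fourierSpinor p (freeDirac p m x))
      (fourierSpinor p x) z, spinorAt_freeDirac m x, spinorAt_matrixMul _ hr
        (fourierSpinor p (freeDirac p m x) - z • fourierSpinor p x)] with ξ e0 e1 e2 e3
    rw [e3, e1, e2, ← sub_smul_one_mulVec, Matrix.mulVec_mulVec,
      resolventSymbol_mul_diracSymbol_sub e0, Matrix.one_mulVec]

theorem mem_resolventSet_freeDirac_of_im_ne_zero (m : ℝ) {z : ℂ} (hz : z.im ≠ 0) :
    z ∈ unboundedResolventSet (freeDirac p m) := by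
  refine mem_resolventSet_freeDirac (abs_pos.2 hz) (Filter.Eventually.of_forall fun ξ => ?_)
    (Filter.Eventually.of_forall fun ξ => ?_)
  · simpa using Complex.abs_im_le_norm ((energy p m ξ : ℂ) - z)
  · simpa using Complex.abs_im_le_norm ((energy p m ξ : ℂ) + z)

theorem isSelfAdjoint_freeDirac (m : ℝ) : IsSelfAdjoint (freeDirac p m) :=
  isSelfAdjoint_of_surjective (dense_freeDirac_domain m) (freeDirac_isFormalAdjoint m) Complex.I
    (exists_sub_smul_eq_of_mem_resolventSet
      (mem_resolventSet_freeDirac_of_im_ne_zero m (by simp)))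
    (exists_sub_smul_eq_of_mem_resolventSet
      (mem_resolventSet_freeDirac_of_im_ne_zero m (by simp)))

end Resolvent

/-! ### Test spinors form a core. -/

section Core

theorem memLp_top_inv_weight (i j : Fin 4) : MemLp (fun ξ : Q3 p =>
    (((max 1 ‖ξ‖ : ℝ) : ℂ)⁻¹ • (1 : Matrix (Fin 4) (Fin 4) ℂ)) i j) ∞ (haar3 p) := by
  have hw : Measurable fun ξ : Q3 p => ((max 1 ‖ξ‖ : ℝ) : ℂ) := by
    have : Continuous fun ξ : Q3 p => ((max 1 ‖ξ‖ : ℝ) : ℂ) := by fun_prop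
    exact this.measurable
  refine memLp_top_of_bound (hw.inv.mul_const _).aestronglyMeasurable 1
    (Filter.Eventually.of_forall fun ξ => ?_)
  have h1 : (1 : ℝ) ≤ max 1 ‖ξ‖ := le_max_left _ _
  rw [Matrix.smul_apply, smul_eq_mul, norm_mul, norm_inv, Complex.norm_real,
    Real.norm_of_nonneg (by positivity), Matrix.one_apply]
  have h2 : (max 1 ‖ξ‖)⁻¹ ≤ 1 := inv_le_one_of_one_le₀ h1
  split_ifs <;> simp [h2]

theorem memLp_top_inv_weight_diracSymbol (m : ℝ) (i j : Fin 4) : MemLp (fun ξ : Q3 p =>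
    (((max 1 ‖ξ‖ : ℝ) : ℂ)⁻¹ • diracSymbol m ξ) i j) ∞ (haar3 p) := by
  have hw : Measurable fun ξ : Q3 p => ((max 1 ‖ξ‖ : ℝ) : ℂ) := by
    have : Continuous fun ξ : Q3 p => ((max 1 ‖ξ‖ : ℝ) : ℂ) := by fun_prop
    exact this.measurable
  refine memLp_top_of_bound (hw.inv.mul
    ((continuous_diracSymbol m).matrix_elem i j).measurable).aestronglyMeasurable (2 + |m|)
    (Filter.Eventually.of_forall fun ξ => ?_)
  have h1 : (1 : ℝ) ≤ max 1 ‖ξ‖ := le_max_left _ _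
  rw [Matrix.smul_apply, smul_eq_mul, norm_mul, norm_inv, Complex.norm_real,
    Real.norm_of_nonneg (by positivity), inv_mul_le_iff₀ (by positivity), mul_comm]
  exact (norm_diracSymbol_apply_le m ξ i j).trans (energy_le_max_one_norm m ξ)

variable (p) in
/-- The operator `h ↦ 𝓕⁻¹(max(1, ‖ξ‖)⁻¹ h)`, a bijection of the Hilbert space onto `H¹`. -/
def sobolevLift : SpinorSpace p →L[ℂ] SpinorSpace p :=
  (fourierSpinor p).symm.toContinuousLinearEquiv.toContinuousLinearMap ∘L
    matrixMul _ memLp_top_inv_weight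

variable (p) in
/-- The bounded operator `h ↦ 𝓕⁻¹(max(1, ‖ξ‖)⁻¹ A h)`, where `A` is the symbol of the free Dirac
operator. -/
def diracLift (m : ℝ) : SpinorSpace p →L[ℂ] SpinorSpace p :=
  (fourierSpinor p).symm.toContinuousLinearEquiv.toContinuousLinearMap ∘L
    matrixMul _ (memLp_top_inv_weight_diracSymbol m)

theorem fourierSpinor_sobolevLift (h : SpinorSpace p) :
    fourierSpinor p (sobolevLift p h) = matrixMul _ memLp_top_inv_weight h :=
  (fourierSpinor p).apply_symm_apply _

theorem fourierSpinor_diracLift (m : ℝ) (h : SpinorSpace p) :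
    fourierSpinor p (diracLift p m h) = matrixMul _ (memLp_top_inv_weight_diracSymbol m) h :=
  (fourierSpinor p).apply_symm_apply _

theorem sobolevLift_mem (h : SpinorSpace p) : sobolevLift p h ∈ sobolevH1 p := by
  refine fourierSpinor_symm_mem_sobolevH1 (memLp_weight_matrixMul _ _ _ (fun i j => ?_) h)
  refine (memLp_top_const ((1 : Matrix (Fin 4) (Fin 4) ℂ) i j)).congr_norm ?_ ?_
  · have hw : Measurable fun ξ : Q3 p => ((max 1 ‖ξ‖ : ℝ) : ℂ) := by
      have : Continuous fun ξ : Q3 p => ((max 1 ‖ξ‖ : ℝ) : ℂ) := by fun_prop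
      exact this.measurable
    exact (hw.mul (hw.inv.mul_const _)).aestronglyMeasurable
  · refine Filter.Eventually.of_forall fun ξ => ?_
    have h1 : ((max 1 ‖ξ‖ : ℝ) : ℂ) ≠ 0 := by
      have : (0 : ℝ) < max 1 ‖ξ‖ := by positivity
      exact_mod_cast this.ne'
    simp only [Matrix.smul_apply, smul_eq_mul]
    rw [mul_inv_cancel_left₀ h1]

theorem freeDirac_sobolevLift (m : ℝ) (h : SpinorSpace p)
    (hmem : sobolevLift p h ∈ (freeDirac p m).domain) :
    freeDirac p m ⟨sobolevLift p h, hmem⟩ = diracLift p m h := by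
  refine (fourierSpinor p).injective (eq_of_spinorAt_ae ?_)
  rw [fourierSpinor_diracLift]
  filter_upwards [spinorAt_freeDirac m ⟨sobolevLift p h, hmem⟩,
    spinorAt_matrixMul _ (memLp_top_inv_weight_diracSymbol m) h,
    spinorAt_matrixMul _ memLp_top_inv_weight h] with ξ e1 e2 e3
  rw [e1, e2]
  simp only [fourierSpinor_sobolevLift]
  rw [e3, Matrix.mulVec_mulVec, Matrix.mul_smul, mul_one]

theorem exists_sobolevLift_eq {ψ : SpinorSpace p} (hψ : ψ ∈ sobolevH1 p) :
    ∃ h, sobolevLift p h = ψ := by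
  have hψ' := mem_sobolevH1_iff.1 hψ
  refine ⟨WithLp.toLp 2 fun i => (hψ' i).toLp _, ?_⟩
  refine (fourierSpinor p).injective (eq_of_spinorAt_ae ?_)
  rw [fourierSpinor_sobolevLift]
  filter_upwards [spinorAt_matrixMul _ memLp_top_inv_weight
    (WithLp.toLp 2 fun i => (hψ' i).toLp _ : SpinorSpace p),
    ae_all_iff.2 fun i => (hψ' i).coeFn_toLp] with ξ e1 e2
  have h1 : ((max 1 ‖ξ‖ : ℝ) : ℂ) ≠ 0 := by
    have : (0 : ℝ) < max 1 ‖ξ‖ := by positivity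
    exact_mod_cast this.ne'
  rw [e1, Matrix.smul_mulVec, Matrix.one_mulVec]
  funext i
  change _ * (hψ' i).toLp _ ξ = _
  rw [e2 i, inv_mul_cancel_left₀ h1]
  rfl

/-- Both division by the locally constant weight and the inverse Fourier transform preserve test
functions. -/
theorem sobolevLift_mem_testSpinors {h : SpinorSpace p} (hh : h ∈ testSpinors p) :
    sobolevLift p h ∈ testSpinors p := by
  intro i
  refine fourierUnitary_symm_mem_range ?_
  obtain ⟨φ, hφ⟩ := hh i
  refine ⟨⟨fun ξ => ((max 1 ‖ξ‖ : ℝ) : ℂ)⁻¹ * (φ : Q3 p → ℂ) ξ,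
    (isLocallyConstant_max_one_norm.comp fun r : ℝ => (r : ℂ)⁻¹).mul φ.2.1, φ.2.2.mul_left⟩, ?_⟩
  refine Lp.ext ?_
  filter_upwards [MemLp.coeFn_toLp (testFun_memLp
    ⟨fun ξ => ((max 1 ‖ξ‖ : ℝ) : ℂ)⁻¹ * (φ : Q3 p → ℂ) ξ,
    (isLocallyConstant_max_one_norm.comp fun r : ℝ => (r : ℂ)⁻¹).mul φ.2.1, φ.2.2.mul_left⟩),
    (testFun_memLp φ).coeFn_toLp, spinorAt_matrixMul _ memLp_top_inv_weight h] with ξ e1 e2 e3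
  refine e1.trans ?_
  have e4 := congrFun e3 i
  rw [Matrix.smul_mulVec, Matrix.one_mulVec] at e4
  refine Eq.trans ?_ e4.symm
  change _ = _ * h i ξ
  rw [← hφ]
  exact congrArg _ e2.symm

/-- The bounded map `h ↦ (sobolevLift p h, diracLift p m h)` has the full graph as its range. By
continuity, the images of the dense set of test spinors, which lie in the graph of the restriction,
are dense in it. -/
theorem isEssentiallySelfAdjoint_freeDirac (m : ℝ) :
    IsEssentiallySelfAdjoint ((freeDirac p m).domRestrict (testSpinors p)) := by
  refine isEssentiallySelfAdjoint_of_le (isSelfAdjoint_freeDirac m) (freeDirac_isFormalAdjoint m)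
    ?_ LinearPMap.domRestrict_le fun q hq => ?_
  · exact dense_testSpinors.mono fun ψ hψ => ⟨hψ, testSpinors_le_sobolevH1 hψ⟩
  · obtain ⟨ψ, hψ1, hψ2⟩ := (LinearPMap.mem_graph_iff _).1 hq
    obtain ⟨h, hh⟩ := exists_sobolevLift_eq ψ.2
    have hq' : q = (sobolevLift p h, diracLift p m h) := by
      refine Prod.ext (hψ1.symm.trans hh.symm) (hψ2.symm.trans ?_)
      rw [← freeDirac_sobolevLift m h (sobolevLift_mem h)]
      congr 1
      exact Subtype.ext hh.symm
    rw [hq']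
    refine map_mem_closure (f := fun h => (sobolevLift p h, diracLift p m h))
      (s := (testSpinors p : Set (SpinorSpace p))) (by fun_prop) (dense_testSpinors h)
      fun g hg => ?_
    refine (LinearPMap.mem_graph_iff _).2
      ⟨⟨sobolevLift p g, sobolevLift_mem_testSpinors hg, sobolevLift_mem g⟩, rfl, ?_⟩
    refine Eq.trans ?_ (freeDirac_sobolevLift m g (sobolevLift_mem g))
    exact LinearPMap.domRestrict_apply rfl

end Core

/-! ### The spectrum as the union of two essential ranges. -/

section Spectrum

/-- For real `z` the gap comes from the definition of the essential range; for non-real `z` it is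
`|z.im|`, since `f` is real. -/
theorem exists_le_norm_sub_of_notMem_essRange {f : Q3 p → ℝ} {z : ℂ}
    (hz : z ∉ Complex.ofReal '' essRange (haar3 p) f) :
    ∃ ε > 0, ∀ᵐ ξ ∂(haar3 p), ε ≤ ‖(f ξ : ℂ) - z‖ := by
  by_cases him : z.im = 0
  · have hre : z.re ∉ essRange (haar3 p) f := fun h => hz ⟨z.re, h, Complex.ext rfl him.symm⟩
    simp only [essRange, Set.mem_ofPred_eq, not_forall, not_lt, nonpos_iff_eq_zero] at hre
    obtain ⟨ε, hε, h0⟩ := hre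
    refine ⟨ε, hε, ?_⟩
    filter_upwards [measure_eq_zero_iff_ae_notMem.1 h0] with ξ hξ
    simp only [not_lt] at hξ
    refine hξ.trans ?_
    simpa using Complex.abs_re_le_norm ((f ξ : ℂ) - z)
  · refine ⟨|z.im|, abs_pos.2 him, Filter.Eventually.of_forall fun ξ => ?_⟩
    simpa using Complex.abs_im_le_norm ((f ξ : ℂ) - z)

theorem energy_ne_zero_of_ne_zero (m : ℝ) {ξ : Q3 p} (hξ : ξ ≠ 0) : energy p m ξ ≠ 0 := by
  intro h
  have h1 := energy_sq m ξ
  rw [h, zero_pow two_ne_zero] at h1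
  refine hξ (funext fun k => ?_)
  have h2 := Finset.single_le_sum (f := fun k => ‖ξ k‖ ^ 2) (fun _ _ => by positivity)
    (Finset.mem_univ k)
  have h3 : ‖ξ k‖ ^ 2 = 0 := by
    have := sq_nonneg m
    have := sq_nonneg ‖ξ k‖
    linarith
  simpa using h3

theorem memLp_indicator_of_subset_closedBall {g : Q3 p → ℂ} (hg : Continuous g) {E : Set (Q3 p)}
    (hE : MeasurableSet E) {r : ℝ} (hr : E ⊆ Metric.closedBall 0 r) :
    MemLp (E.indicator g) 2 (haar3 p) := by
  obtain ⟨C, hC⟩ := (isCompact_closedBall (0 : Q3 p) r).exists_bound_of_continuousOn hg.continuousOn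
  have hfin : haar3 p E ≠ ∞ :=
    ((measure_mono hr).trans_lt (isCompact_closedBall (0 : Q3 p) r).measure_lt_top).ne
  refine MemLp.mono (memLp_indicator_const 2 hE C (Or.inr hfin))
    (hg.aestronglyMeasurable.indicator hE) (Filter.Eventually.of_forall fun ξ => ?_)
  by_cases hξ : ξ ∈ E
  · rw [Set.indicator_of_mem hξ, Set.indicator_of_mem hξ]
    exact (hC ξ (hr hξ)).trans (le_abs_self C)
  · rw [Set.indicator_of_notMem hξ, norm_zero]
    exact norm_nonneg _

/-- A bounded set of positive measure on which a continuous branch `f` of `±λ` is close to `y` and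
on which a column of `A + f` does not vanish. -/
theorem exists_set_pos_measure {m : ℝ} {f : Q3 p → ℝ} (hf : Continuous f)
    (hsq : ∀ ξ, f ξ ^ 2 = energy p m ξ ^ 2) {y : ℝ} (hy : y ∈ essRange (haar3 p) f) {ε : ℝ}
    (hε : 0 < ε) : ∃ (E : Set (Q3 p)) (r : ℝ) (j : Fin 4), MeasurableSet E ∧
      E ⊆ Metric.closedBall 0 r ∧ 0 < haar3 p E ∧
      ∀ ξ ∈ E, |f ξ - y| < ε ∧ (diracSymbol m ξ + (f ξ : ℂ) • 1) j j ≠ 0 := by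
  set S := {ξ : Q3 p | |f ξ - y| < ε} with hS
  have hSm : MeasurableSet S := by
    have : IsOpen S := isOpen_lt (by fun_prop) continuous_const
    exact this.measurableSet
  -- The origin is not isolated, so Haar measure has no atoms. Removing the origin, the only
  -- possible zero of $\lambda$, is therefore harmless.
  have : (nhdsWithin (0 : Q3 p) {0}ᶜ).NeBot := Module.punctured_nhds_neBot ℚ_[p] (Q3 p) 0
  have hpos : haar3 p (⋃ n : ℕ, (S \ {0}) ∩ Metric.closedBall 0 n) ≠ 0 := by
    rw [← Set.inter_iUnion, Metric.iUnion_closedBall_nat, Set.inter_univ,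
      measure_sdiff_null (measure_singleton 0)]
    exact (hy ε hε).ne'
  obtain ⟨n, hn⟩ := exists_measure_pos_of_not_measure_iUnion_null hpos
  set D := (S \ {0}) ∩ Metric.closedBall 0 (n : ℝ) with hD
  have hDm : MeasurableSet D :=
    (hSm.diff (measurableSet_singleton 0)).inter measurableSet_closedBall
  have hZ (j : Fin 4) : MeasurableSet {ξ : Q3 p | (diracSymbol m ξ + (f ξ : ℂ) • 1) j j ≠ 0} := by
    have hc : Continuous fun ξ : Q3 p => (diracSymbol m ξ + (f ξ : ℂ) • 1) j j := by
      have h1 := continuous_diracSymbol (p := p) m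
      fun_prop
    exact (isOpen_ne_fun hc continuous_const).measurableSet
  -- These two diagonal entries are $f+m$ and $f-m$; if both vanished, then $f=0$ and $\lambda=0$,
  -- which is impossible off the origin.
  have hcover : D ⊆ (D ∩ {ξ | (diracSymbol m ξ + (f ξ : ℂ) • 1) 0 0 ≠ 0}) ∪
      (D ∩ {ξ | (diracSymbol m ξ + (f ξ : ℂ) • 1) 2 2 ≠ 0}) := by
    intro ξ hξ
    rw [← Set.inter_union_distrib_left]
    refine ⟨hξ, ?_⟩
    by_contra h
    simp only [Set.mem_union, Set.mem_ofPred_eq, not_or, not_not, diracSymbol_eq] at h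
    obtain ⟨h0, h2⟩ := h
    simp at h0 h2
    have hf0 : f ξ = 0 := by
      have h0' : m + f ξ = 0 := by exact_mod_cast h0
      have h2' : -m + f ξ = 0 := by exact_mod_cast h2
      linarith
    refine energy_ne_zero_of_ne_zero m (ξ := ξ) (fun h => hξ.1.2 h) ?_
    have := hsq ξ
    rw [hf0] at this
    exact pow_eq_zero_iff two_ne_zero |>.1 (this.symm.trans (by norm_num))
  have hor := hn.trans_le ((measure_mono hcover).trans (measure_union_le _ _))
  rcases add_pos_iff.1 hor with h | h
  · exact ⟨_, n, 0, hDm.inter (hZ 0), fun ξ hξ => hξ.1.2, h, fun ξ hξ => ⟨hξ.1.1.1, hξ.2⟩⟩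
  · exact ⟨_, n, 2, hDm.inter (hZ 2), fun ξ hξ => hξ.1.2, h, fun ξ hξ => ⟨hξ.1.1.1, hξ.2⟩⟩

/-- From $A^2=l^2$: every nonzero column of $A+l$ is an eigenvector of $A$ for $l$. -/
theorem diracSymbol_mul_add_smul {m l : ℝ} {ξ : Q3 p} (h : l ^ 2 = energy p m ξ ^ 2) :
    diracSymbol m ξ * (diracSymbol m ξ + (l : ℂ) • 1) =
      (l : ℂ) • (diracSymbol m ξ + (l : ℂ) • 1) := by
  have h' : (energy p m ξ : ℂ) ^ 2 = (l : ℂ) * l := by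
    rw [← sq]
    exact_mod_cast h.symm
  rw [mul_add, diracSymbol_mul_self, h', smul_add, smul_smul, Matrix.mul_smul, mul_one, add_comm]

/-- The approximate eigenvector is, on the Fourier side, column `j` of $A+f$ cut off to `E`. There
$A-y$ acts on it as the scalar $f-y$, of modulus below `ε`; its `j`-th entry is nonzero throughout
`E`, so the spinor is not zero. -/
theorem notMem_resolventSet_freeDirac {m : ℝ} {f : Q3 p → ℝ} (hf : Continuous f)
    (hsq : ∀ ξ, f ξ ^ 2 = energy p m ξ ^ 2) {y : ℝ} (hy : y ∈ essRange (haar3 p) f) :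
    (y : ℂ) ∉ unboundedResolventSet (freeDirac p m) := by
  refine notMem_resolventSet_of_approx fun ε hε => ?_
  obtain ⟨E, r, j, hE, hEr, hpos, hEf⟩ := exists_set_pos_measure hf hsq hy hε
  set a : Fin 4 → Q3 p → ℂ := fun i ξ => (diracSymbol m ξ + (f ξ : ℂ) • 1) i j with ha
  have hac (i : Fin 4) : Continuous (a i) := by
    have h1 := continuous_diracSymbol (p := p) m
    fun_prop
  have hg (i : Fin 4) := memLp_indicator_of_subset_closedBall (hac i) hE hEr
  set g : SpinorSpace p := WithLp.toLp 2 fun i => (hg i).toLp _ with hgdef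
  have hgae (i : Fin 4) : g i =ᵐ[haar3 p] E.indicator (a i) := (hg i).coeFn_toLp
  have hmem : (fourierSpinor p).symm g ∈ sobolevH1 p := by
    refine fourierSpinor_symm_mem_sobolevH1 fun i => ?_
    have hwc : Continuous fun ξ : Q3 p => ((max 1 ‖ξ‖ : ℝ) : ℂ) * a i ξ := by
      have := hac i
      fun_prop
    refine (memLp_congr_ae ?_).1 (memLp_indicator_of_subset_closedBall hwc hE hEr)
    filter_upwards [hgae i] with ξ hξ
    rw [hξ, Set.indicator_mul_right]
  refine ⟨⟨(fourierSpinor p).symm g, hmem⟩, ?_, ?_⟩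
  · intro h0
    have hg0 : g = 0 := by simpa using h0
    refine hpos.ne' (measure_eq_zero_iff_ae_notMem.2 ?_)
    filter_upwards [hgae j, Lp.coeFn_zero ℂ 2 (haar3 p)] with ξ e1 e2 hξ
    refine (hEf ξ hξ).2 ?_
    rw [Set.indicator_of_mem hξ] at e1
    rw [← show a j ξ = (diracSymbol m ξ + (f ξ : ℂ) • 1) j j from rfl, ← e1, hg0]
    exact e2
  · set x : (freeDirac p m).domain := ⟨(fourierSpinor p).symm g, hmem⟩ with hx
    have hxg : fourierSpinor p (x : SpinorSpace p) = g := (fourierSpinor p).apply_symm_apply g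
    rw [← (fourierSpinor p).norm_map, ← (fourierSpinor p).norm_map (x : SpinorSpace p), map_sub,
      map_smul, hxg]
    refine norm_spinor_le hε.le fun i => Lp.norm_le_mul_norm_of_ae_le_mul ?_
    filter_upwards [spinorAt_sub_smul (fourierSpinor p (freeDirac p m x)) g y,
      spinorAt_freeDirac m x, ae_all_iff.2 hgae] with ξ e1 e2 e3
    have e4 : spinorAt g ξ = fun k => E.indicator (a k) ξ := funext e3
    have e5 : (fourierSpinor p (freeDirac p m x) - (y : ℂ) • g) i ξ =
        (diracSymbol m ξ *ᵥ spinorAt g ξ - (y : ℂ) • spinorAt g ξ) i := by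
      rw [← hxg, ← e2, hxg, ← e1]
      rfl
    rw [e5, e4, e3 i]
    by_cases hξ : ξ ∈ E
    · simp only [Set.indicator_of_mem hξ]
      have e6 : diracSymbol m ξ *ᵥ (fun k => a k ξ) = (f ξ : ℂ) • fun k => a k ξ := by
        funext k
        exact congrFun (congrFun (diracSymbol_mul_add_smul (hsq ξ)) k) j
      rw [e6, ← sub_smul, Pi.smul_apply, norm_smul, ← Complex.ofReal_sub, Complex.norm_real]
      gcongr
      exact (hEf ξ hξ).1.le
    · simp only [Set.indicator_of_notMem hξ]
      have e6 : diracSymbol m ξ *ᵥ (fun _ => 0) = 0 := Matrix.mulVec_zero _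
      rw [e6]
      simp

theorem unboundedSpectrum_freeDirac (m : ℝ) :
    unboundedSpectrum (freeDirac p m) =
      Complex.ofReal '' (essRange (haar3 p) (energy p m) ∪
        essRange (haar3 p) fun ξ => -energy p m ξ) := by
  rw [Set.image_union]
  ext z
  constructor
  · intro hz
    by_contra h
    rw [Set.mem_union, not_or] at h
    obtain ⟨ε, hε, h1⟩ := exists_le_norm_sub_of_notMem_essRange h.1
    obtain ⟨δ, hδ, h2⟩ := exists_le_norm_sub_of_notMem_essRange h.2
    refine hz (mem_resolventSet_freeDirac (lt_min hε hδ) ?_ ?_)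
    · filter_upwards [h1] with ξ hξ
      exact (min_le_left _ _).trans hξ
    · filter_upwards [h2] with ξ hξ
      refine (min_le_right _ _).trans (hξ.trans_eq ?_)
      rw [Complex.ofReal_neg, ← norm_neg, neg_sub, sub_neg_eq_add, add_comm]
  · rintro (⟨y, hy, rfl⟩ | ⟨y, hy, rfl⟩)
    · exact notMem_resolventSet_freeDirac (continuous_energy m) (fun _ => rfl) hy
    · exact notMem_resolventSet_freeDirac (continuous_energy m).neg (fun _ => neg_sq _) hy

end Spectrum

end DiracOperator

end PadicDirac

end

theorem mainTheorem4 (p : ℕ) [Fact p.Prime] (m : ℝ) :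
    (Dense (PadicDirac.testSpinors p : Set (PadicDirac.SpinorSpace p)) ∧
      PadicDirac.testSpinors p ≤ PadicDirac.sobolevH1 p ∧
      PadicDirac.IsEssentiallySelfAdjoint
        ((PadicDirac.freeDirac p m).domRestrict (PadicDirac.testSpinors p))) ∧
    ((PadicDirac.freeDirac p m).domain = PadicDirac.sobolevH1 p ∧
      IsSelfAdjoint (PadicDirac.freeDirac p m)) ∧
    PadicDirac.unboundedSpectrum (PadicDirac.freeDirac p m) =
      Complex.ofReal '' (PadicDirac.essRange (PadicDirac.haar3 p) (PadicDirac.energy p m) ∪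
        PadicDirac.essRange (PadicDirac.haar3 p) (fun ξ => -PadicDirac.energy p m ξ)) :=
  ⟨⟨PadicDirac.dense_testSpinors, PadicDirac.testSpinors_le_sobolevH1,
    PadicDirac.isEssentiallySelfAdjoint_freeDirac m⟩,
    ⟨rfl, PadicDirac.isSelfAdjoint_freeDirac m⟩, PadicDirac.unboundedSpectrum_freeDirac m⟩
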